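/- Let $K$ be a field of characteristic $0$ (for instance $\mathbb{C}$). A strict partition is a sequence of integers $\lambda_1>\lambda_2>\cdots>\lambda_\ell\ge 0$; its length $\ell(\lambda)=\ell$ counts a part $0$. **Lattice models.** A vertex has spins in $\{+,-\}$ on its (left, top, right, bottom) edges. In row $i$ of the model $\overline{\mathfrak S}$ the admissible vertices and their weights are $a_1^{(i)}:(+,+,+,+)$, $a_2^{(i)}:(-,-,-,-)$, $b_1^{(i)}:(+,-,+,-)$, $b_2^{(i)}:(-,+,-,+)$, $c_1^{(i)}:(-,+,+,-)$, $c_2^{(i)}:(+,-,-,+)$; in the dual model $\overline{\mathfrak S}^*$ they are the same except that $c_1^{(i)}:(+,+,-,-)$ and $c_2^{(i)}:(-,-,+,+)$. All other vertices have weight $0$. For $N\ge 0$, strict partitions $\lambda,\mu$ and $M\ge\max(\lambda_1,\mu_1)$, the model $\overline{\mathfrak S}_{\lambda/\mu}$ is the grid with $N$ rows, numbered $1,\dots,N$ from bottom to top, and columns $0,\dots,M$ from left to right, with all left and right boundary spins $+$, bottom boundary spins $-$ exactly on the parts of $\lambda$, and top boundary spins $-$ exactly on the parts of $\mu$. In $\overline{\mathfrak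 S}^*_{\lambda/\mu}$ the rows are numbered from top to bottom, $\lambda$ is at the top and $\mu$ at the bottom. The partition function $Z$ is the sum over all states of the product of the vertex weights. The weights are free fermionic if $a_1^{(i)}a_2^{(i)}+b_1^{(i)}b_2^{(i)}=c_1^{(i)}c_2^{(i)}$ for all $i$. For sequences $x_i,y_i,A_i,B_i\in K$ $(i\ge 1)$, $\mathfrak S$ is the model $\overline{\mathfrak S}$ with $$(a_1,a_2,b_1,b_2,c_1,c_2)^{(i)}=(A_i,\;y_iA_iB_i,\;A_iB_i,\;x_iA_i,\;(x_i+y_i)A_iB_i,\;A_i),$$ and, for $A_i,B_i\neq 0$, $\mathfrak S^*$ is the model $\overline{\mathfrak S}^*$ with $$(a_1,a_2,b_1,b_2,c_1,c_2)^{(i)}=(A_i^{-1},\;x_iA_i^{-1}B_i^{-1},\;A_i^{-1}B_i^{-1},\;y_iA_i^{-1},\;(x_i+y_i)A_i^{-1},\;A_i^{-1}B_i^{-1}).$$ **Hamiltonians.** Let $\psi^*_p,\psi_p$ $(p\in\mathbb Z+\tfrac12)$ be the creation and annihilation operators on fermionic Fock space over $K$, whose vacuum $|0\rangle$ has exactly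 the negative positions occupied; put $|\lambda\rangle=\psi^*_{\lambda_1+1/2}\cdots\psi^*_{\lambda_\ell+1/2}|0\rangle$, let $\langle\lambda|=\langle 0|\psi_{\lambda_\ell+1/2}\cdots\psi_{\lambda_1+1/2}$ be the dual vector, and $J_n=\sum_i{:}\psi^*_{i-n}\psi_i{:}$. For parameters $s_k^{(j)}\in K$ $(j\ge1,\ k\in\mathbb Z\setminus\{0\})$ let $H_\pm=\sum_{k\ge1}\sum_{j=1}^N s_{\pm k}^{(j)}J_{\pm k}$. Consider the conditions $$(\ast)\quad Z(\overline{\mathfrak S}_{\lambda/\mu})=C(N,M,\ell(\lambda))\,\langle\mu|e^{H_+}|\lambda\rangle,\qquad(\ast\ast)\quad Z(\overline{\mathfrak S}^*_{\lambda/\mu})=C(N,M,\ell(\lambda))\,\langle\lambda|e^{H_-}|\mu\rangle,$$ each for all strict partitions $\lambda,\mu$, all $N\ge0$ and all $M\ge\max(\lambda_1,\mu_1)$. Then: 1. (a) If $s_k^{(j)}=\frac1k\left(x_j^k+(-1)^{k-1}y_j^k\right)$ for all $k,j\ge1$, then $\mathfrak S$ satisfies $(\ast)$ with $C=\prod_{i=1}^N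 A_i^{M+1}B_i^{\ell(\lambda)}$. If all $A_i,B_i$ are nonzero, then, conversely, $(\ast)$ with this $C$ forces these values of $s_k^{(j)}$. (b) Suppose that $c_1^{(i)},c_2^{(i)}\ne0$ for all $i$. If the weights of $\overline{\mathfrak S}$ are not free fermionic, then $(\ast)$ does not hold for any choice of the $s_k^{(j)}$ and of $C$. If moreover $a_1^{(i)},b_1^{(i)}\neq0$ for all $i$, then $(\ast)$ holds for some choice of the $s_k^{(j)}$ and $C$ if and only if the weights are free fermionic. 2. (a) If all $A_i,B_i$ are nonzero, then $\mathfrak S^*$ satisfies $(\ast\ast)$ with $C=\prod_{i=1}^N A_i^{-(M+1)}B_i^{-\ell(\lambda)}$ if and only if $s_{-k}^{(j)}=\frac1k\left(y_j^k+(-1)^{k-1}x_j^k\right)$ for all $k,j\ge1$. (b) The statement of 1(b) holds for $\overline{\mathfrak S}^*$, $(\ast\ast)$ and the $s_{-k}^{(j)}$. -/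

import Mathlib

noncomputable section

namespace SixVertex

/-! ### Strict partitions -/

/-- A strict partition `λ₁ > λ₂ > ⋯ > λ_ℓ ≥ 0` is given by its finite set of parts. The part `0` is
allowed and counts for the length, so the length `ℓ(λ)` is the cardinality. -/
abbrev StrictPartition : Type := Finset ℕ

/-! ### Six-vertex models -/

/-- The spins on the edges; a `minus` is a particle. -/
inductive Spin : Type
  | plus
  | minus
  deriving DecidableEq

instance : Fintype Spin where
  elems := {Spin.plus, Spin.minus}
  complete := by intro s; cases s <;> simp

/-- The six Boltzmann weights of one row. -/
structure Weights (K : Type*) where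
  a₁ : K
  a₂ : K
  b₁ : K
  b₂ : K
  c₁ : K
  c₂ : K

/-- The free fermion condition for the weights of one row. -/
def Weights.FreeFermionic {K : Type*} [Field K] (w : Weights K) : Prop :=
  w.a₁ * w.a₂ + w.b₁ * w.b₂ = w.c₁ * w.c₂

open Spin in
/-- Weight of a vertex of the model `𝔖`, as a function of the spins on its left, top, right and
bottom edges (in this order); non-admissible vertices have weight `0`. -/
def Weights.vertex {K : Type*} [Field K] (w : Weights K) : Spin → Spin → Spin → Spin → K
  | plus, plus, plus, plus => w.a₁
  | minus, minus, minus, minus => w.a₂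
  | plus, minus, plus, minus => w.b₁
  | minus, plus, minus, plus => w.b₂
  | minus, plus, plus, minus => w.c₁
  | plus, minus, minus, plus => w.c₂
  | _, _, _, _ => 0

open Spin in
/-- Weight of a vertex of the dual model `𝔖*` (left, top, right, bottom). -/
def Weights.dualVertex {K : Type*} [Field K] (w : Weights K) : Spin → Spin → Spin → Spin → K
  | plus, plus, plus, plus => w.a₁
  | minus, minus, minus, minus => w.a₂
  | plus, minus, plus, minus => w.b₁
  | minus, plus, minus, plus => w.b₂
  | plus, plus, minus, minus => w.c₁
  | minus, minus, plus, plus => w.c₂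
  | _, _, _, _ => 0

/-- The boundary spins on columns `0, …, M` with `-` exactly on the parts of `lam`. -/
def boundary (M : ℕ) (lam : StrictPartition) (c : Fin (M + 1)) : Spin :=
  if (c : ℕ) ∈ lam then Spin.minus else Spin.plus

/-- Partition function of the model `𝔖_{λ/μ}` with arbitrary row weights, `N` rows (numbered from
bottom to top) and columns `0, …, M` (from left to right). The spins of a state are `v` on the
vertical edges (`v 0` is the bottom boundary `λ`, `v N` the top boundary `μ`) and `h` on the
horizontal edges (`h i 0` and `h i (M + 1)` are the left and right boundary edges, both `+`).
`W i` holds the weights of the `(i+1)`-st row. -/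
def Z {K : Type*} [Field K] (W : ℕ → Weights K) (N M : ℕ) (lam mu : StrictPartition) : K :=
  ∑ v : Fin (N + 1) → Fin (M + 1) → Spin, ∑ h : Fin N → Fin (M + 2) → Spin,
    if v 0 = boundary M lam ∧ v (Fin.last N) = boundary M mu ∧
        ∀ i, h i 0 = Spin.plus ∧ h i (Fin.last (M + 1)) = Spin.plus then
      ∏ i : Fin N, ∏ c : Fin (M + 1),
        (W i).vertex (h i c.castSucc) (v i.succ c) (h i c.succ) (v i.castSucc c)
    else 0

/-- Partition function of the dual model `𝔖*_{λ/μ}`. Here the rows are numbered from top to bottom: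
`v 0` is the top boundary `λ` and `v N` the bottom boundary `μ`. -/
def dualZ {K : Type*} [Field K] (W : ℕ → Weights K) (N M : ℕ) (lam mu : StrictPartition) : K :=
  ∑ v : Fin (N + 1) → Fin (M + 1) → Spin, ∑ h : Fin N → Fin (M + 2) → Spin,
    if v 0 = boundary M lam ∧ v (Fin.last N) = boundary M mu ∧
        ∀ i, h i 0 = Spin.plus ∧ h i (Fin.last (M + 1)) = Spin.plus then
      ∏ i : Fin N, ∏ c : Fin (M + 1),
        (W i).dualVertex (h i c.castSucc) (v i.castSucc c) (h i c.succ) (v i.succ c)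
    else 0

/-- The weights of `𝔖(x, y, A, B)`. -/
def weights {K : Type*} [Field K] (x y A B : ℕ → K) (i : ℕ) : Weights K where
  a₁ := A i
  a₂ := y i * A i * B i
  b₁ := A i * B i
  b₂ := x i * A i
  c₁ := (x i + y i) * A i * B i
  c₂ := A i

/-- The weights of `𝔖*(x, y, A, B)`. -/
def dualWeights {K : Type*} [Field K] (x y A B : ℕ → K) (i : ℕ) : Weights K where
  a₁ := (A i)⁻¹
  a₂ := x i * (A i)⁻¹ * (B i)⁻¹
  b₁ := (A i)⁻¹ * (B i)⁻¹
  b₂ := y i * (A i)⁻¹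
  c₁ := (x i + y i) * (A i)⁻¹
  c₂ := (A i)⁻¹ * (B i)⁻¹

/-! ### Classical fermionic Fock space

The fermion modes are labelled by integers: the integer `p` stands for the half-integer `p + 1/2`.
Fock space is realised as the semi-infinite wedge space, `ψ*_p` being the wedge product with `v_p`
and `ψ_p` the contraction. -/

/-- A particle configuration: a set of occupied positions which differs from the set of negative
positions only finitely. It stands for the semi-infinite wedge `v_{p₁} ∧ v_{p₂} ∧ ⋯` of its elements
`p₁ > p₂ > ⋯`. -/
@[ext]
structure Maya where
  occ : Set ℤ
  finite_symmDiff : (symmDiff occ (Set.Iio 0)).Finite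

namespace Maya

/-- The vacuum: exactly the negative positions are occupied. -/
def vacuum : Maya where
  occ := Set.Iio 0
  finite_symmDiff := by simp

/-- Add a particle at `p`. -/
def insert (S : Maya) (p : ℤ) : Maya where
  occ := Insert.insert p S.occ
  finite_symmDiff := by
    refine (S.finite_symmDiff.union (Set.finite_singleton p)).subset ?_
    intro q hq
    simp only [Set.mem_symmDiff, Set.mem_insert_iff, Set.mem_union, Set.mem_singleton_iff] at hq ⊢
    tauto

/-- Remove the particle at `p`. -/
def erase (S : Maya) (p : ℤ) : Maya where
  occ := S.occ \ {p}
  finite_symmDiff := by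
    refine (S.finite_symmDiff.union (Set.finite_singleton p)).subset ?_
    intro q hq
    simp only [Set.mem_symmDiff, Set.mem_sdiff, Set.mem_union, Set.mem_singleton_iff] at hq ⊢
    tauto

/-- The sign of moving `v_p` past the particles to the right of position `p`. -/
def sign (K : Type*) [Field K] (S : Maya) (p : ℤ) : K :=
  (-1) ^ {q : ℤ | q ∈ S.occ ∧ p < q}.ncard

end Maya

/-- Fock space, with the particle configurations as basis. -/
abbrev Fock (K : Type*) [Field K] : Type _ := Maya →₀ K

variable (K : Type*) [Field K]

/-- The vacuum vector `|0⟩`. -/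
def vac : Fock K := Finsupp.single Maya.vacuum 1

open Classical in
/-- The creation operator `ψ*_p`. -/
def psiStar (p : ℤ) : Module.End K (Fock K) :=
  Finsupp.linearCombination K fun S : Maya =>
    if p ∈ S.occ then 0 else Finsupp.single (S.insert p) (S.sign K p)

open Classical in
/-- The annihilation operator `ψ_p`. -/
def psi (p : ℤ) : Module.End K (Fock K) :=
  Finsupp.linearCombination K fun S : Maya =>
    if p ∈ S.occ then Finsupp.single (S.erase p) (S.sign K p) else 0

/-- The vacuum expectation value `⟨X⟩ = ⟨0|X|0⟩`. -/
def vacuumExpectation (X : Module.End K (Fock K)) : K := X (vac K) Maya.vacuum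

/-- The normally ordered product `:ψ*_j ψ_i: = ψ*_j ψ_i - ⟨ψ*_j ψ_i⟩`. -/
def normalOrdered (j i : ℤ) : Module.End K (Fock K) :=
  psiStar K j * psi K i - vacuumExpectation K (psiStar K j * psi K i) • 1

/-- The current operator `J_n = ∑_i :ψ*_{i-n} ψ_i:`, where on each basis vector only finitely many
terms are nonzero. -/
def current (n : ℤ) : Module.End K (Fock K) :=
  Finsupp.linearCombination K fun S : Maya =>
    ∑ᶠ i : ℤ, normalOrdered K (i - n) i (Finsupp.single S 1)

/-- `|λ⟩ = ψ*_{λ₁} ψ*_{λ₂} ⋯ ψ*_{λ_ℓ} |0⟩`. -/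
def ket (lam : StrictPartition) : Fock K :=
  ((lam.sort (· ≥ ·)).map fun p : ℕ => psiStar K (p : ℤ)).prod (vac K)

/-- `⟨λ|v⟩ = ⟨0| ψ_{λ_ℓ} ⋯ ψ_{λ₂} ψ_{λ₁} v`. -/
def bra (lam : StrictPartition) (v : Fock K) : K :=
  ((lam.sort (· ≤ ·)).map fun p : ℕ => psi K (p : ℤ)).prod v Maya.vacuum

variable {K}

/-- The matrix element `⟨α| e^H |β⟩ = ∑_m ⟨α| H^m |β⟩ / m!` for `H = ∑_{k ≥ 1} t_k J_k`
(if `ε = 1`) or `H = ∑_{k ≥ 1} t_k J_{-k}` (if `ε = -1`), with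
`⟨α| H^m |β⟩ = ∑_{k₁, …, k_m ≥ 1} t_{k₁} ⋯ t_{k_m} ⟨α| J_{εk₁} ⋯ J_{εk_m} |β⟩`. As `J_n` lowers the
energy by `n`, only finitely many terms of the sums are nonzero, for both signs. -/
def expElement (ε : ℤ) (t : ℕ+ → K) (α β : StrictPartition) : K :=
  ∑ᶠ m : ℕ, ((m.factorial : K))⁻¹ *
    ∑ᶠ k : Fin m → ℕ+, (∏ i, t (k i)) *
      bra K α ((List.ofFn fun i => current K (ε * (k i : ℤ))).prod (ket K β))

/-- `⟨α| e^{H₊} |β⟩` for `H₊ = ∑_{k ≥ 1} s_k J_k`, `s_k = ∑_{j=1}^N s_k^{(j)}`. Here `s j k` is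
`s_k^{(j+1)}`, for `k ∈ ℤ \ {0}`. -/
def expPlus (s : ℕ → ℤ → K) (N : ℕ) (α β : StrictPartition) : K :=
  expElement 1 (fun k => ∑ j ∈ Finset.range N, s j (k : ℤ)) α β

/-- `⟨α| e^{H₋} |β⟩` for `H₋ = ∑_{k ≥ 1} s_{-k} J_{-k}`, `s_{-k} = ∑_{j=1}^N s_{-k}^{(j)}`. -/
def expMinus (s : ℕ → ℤ → K) (N : ℕ) (α β : StrictPartition) : K :=
  expElement (-1) (fun k => ∑ j ∈ Finset.range N, s j (-(k : ℤ))) α β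

/-! ### Matching -/

/-- The model with row weights `W` matches `e^{H₊}` with extra factor `C N M ℓ(λ)`, for all strict
partitions `λ, μ`, all `N`, and all `M ≥ max(λ₁, μ₁)`. -/
def Matches (W : ℕ → Weights K) (s : ℕ → ℤ → K) (C : ℕ → ℕ → ℕ → K) : Prop :=
  ∀ (N M : ℕ) (lam mu : StrictPartition), (∀ p ∈ lam, p ≤ M) → (∀ p ∈ mu, p ≤ M) →
    Z W N M lam mu = C N M lam.card * expPlus s N mu lam

/-- The dual model with row weights `W` matches `e^{H₋}` with extra factor `C N M ℓ(λ)`. -/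
def DualMatches (W : ℕ → Weights K) (s : ℕ → ℤ → K) (C : ℕ → ℕ → ℕ → K) : Prop :=
  ∀ (N M : ℕ) (lam mu : StrictPartition), (∀ p ∈ lam, p ≤ M) → (∀ p ∈ mu, p ≤ M) →
    dualZ W N M lam mu = C N M lam.card * expMinus s N lam mu

/-- The factor `∏_{i=1}^N A_i^{M+1} B_i^ℓ`. -/
def factor (A B : ℕ → K) (N M l : ℕ) : K :=
  ∏ i ∈ Finset.range N, A i ^ (M + 1) * B i ^ l

end SixVertex

end

/-! Identify a strict partition with a wedge `v_{λ₁} ∧ ⋯ ∧ v_{λ_ℓ}`. The partition function of `N`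
rows is then a matrix element of a product of row transfer operators `T` on the exterior algebra,
and `e^{H₊}` acts on it as the multiplicative extension `Γ(e^h)` of `e^h`, where `h = ∑ s_k X^k`
and `X` is the shift `v_p ↦ v_{p-1}`. For the weights `𝔖(x, y, 1, 1)`, reading a row from left to
right shows that `T` carries the wedge product with `(1 - x X) v_p` to the wedge product with
`(1 + y X) v_p`, so that `T = Γ((1 + y X) / (1 - x X))`, and `log ((1 + y X) / (1 - x X))` has the
coefficients `(x^k + (-1)^{k-1} y^k) / k`. Free fermionic weights are reduced to this case by
rescaling `c₁`, `c₂`.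

Conversely, matching for all `N` implies matching row by row, and the matrix elements of a row
from `{1}` to `{0}` and from `{2}` to `{0}` determine the first two coefficients of `e^h`. The
matrix element from `{1, 2}` to `{0, 1}`, a determinant in these coefficients, then gives the free
fermion condition. -/

noncomputable section

namespace SixVertex

/-! ### Finite wedges -/

section FinWedge

variable {K : Type*} [Field K]

/-- The exterior algebra on `v_0, v_1, …`, realised on the finite sets of indices. -/
def FinWedge (K : Type*) [Field K] : Type _ := Finset ℕ →₀ K

instance : AddCommGroup (FinWedge K) := inferInstanceAs (AddCommGroup (Finset ℕ →₀ K))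

instance : Module K (FinWedge K) := inferInstanceAs (Module K (Finset ℕ →₀ K))

/-- The basis of the exterior algebra: `S` is the wedge `v_{p₁} ∧ v_{p₂} ∧ ⋯` of its elements
`p₁ > p₂ > ⋯`. -/
def wedge (K : Type*) [Field K] : Module.Basis (Finset ℕ) K (FinWedge K) :=
  .ofRepr (LinearEquiv.refl K (Finset ℕ →₀ K))

/-- The vector `v_p` of the one-particle space. -/
abbrev mode (K : Type*) [Field K] (p : ℕ) : ℕ →₀ K := Finsupp.single p 1

/-- The sign of moving `v_p` past the elements of `S` above `p`. -/
def wedgeSign (K : Type*) [Field K] (S : Finset ℕ) (p : ℕ) : K :=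
  (-1) ^ (S.filter (p < ·)).card

/-- Wedge product with `v_p` from the left. -/
def create (K : Type*) [Field K] (p : ℕ) : Module.End K (FinWedge K) :=
  (wedge K).constr K fun S =>
    if p ∈ S then 0 else wedgeSign K S p • wedge K (insert p S)

/-- Contraction with `v_p`. -/
def annihilate (K : Type*) [Field K] (p : ℕ) : Module.End K (FinWedge K) :=
  (wedge K).constr K fun S =>
    if p ∈ S then wedgeSign K S p • wedge K (S.erase p) else 0

theorem create_wedge (p : ℕ) (S : Finset ℕ) :
    create K p (wedge K S) = if p ∈ S then 0 else wedgeSign K S p • wedge K (insert p S) :=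
  (wedge K).constr_basis K _ S

theorem annihilate_wedge (p : ℕ) (S : Finset ℕ) :
    annihilate K p (wedge K S) = if p ∈ S then wedgeSign K S p • wedge K (S.erase p) else 0 :=
  (wedge K).constr_basis K _ S

theorem wedgeSign_insert {S : Finset ℕ} {q : ℕ} (hq : q ∉ S) (p : ℕ) :
    wedgeSign K (insert q S) p = if p < q then -wedgeSign K S p else wedgeSign K S p := by
  unfold wedgeSign
  rw [Finset.filter_insert]
  split_ifs with h
  · rw [Finset.card_insert_of_notMem (by simp [hq]), pow_succ, mul_neg_one]
  · rfl

theorem wedgeSign_erase {S : Finset ℕ} {q : ℕ} (hq : q ∈ S) (p : ℕ) :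
    wedgeSign K (S.erase q) p = if p < q then -wedgeSign K S p else wedgeSign K S p := by
  have := wedgeSign_insert (K := K) (Finset.notMem_erase q S) p
  rw [Finset.insert_erase hq] at this
  grind

theorem wedgeSign_mul_self (S : Finset ℕ) (p : ℕ) : wedgeSign K S p * wedgeSign K S p = 1 := by
  rw [wedgeSign, ← mul_pow, neg_one_mul, neg_neg, one_pow]

theorem create_mul_self (p : ℕ) : create K p * create K p = 0 := by
  refine (wedge K).ext fun S => ?_
  by_cases hp : p ∈ S <;> simp [create_wedge, hp]

theorem create_mul_create (p q : ℕ) : create K p * create K q = -(create K q * create K p) := by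
  refine (wedge K).ext fun S => ?_
  simp only [Module.End.mul_apply, LinearMap.neg_apply, create_wedge]
  by_cases hp : p ∈ S <;> by_cases hq : q ∈ S
  · simp [hp, hq]
  · simp [hp, hq, create_wedge]
  · simp [hp, hq, create_wedge]
  · rcases lt_trichotomy p q with h | rfl | h
    · simp [hp, hq, create_wedge, wedgeSign_insert, h, h.ne, h.ne', h.le, smul_smul, mul_comm,
        Finset.insert_comm p q]
    · simp [hp, create_wedge]
    · simp [hp, hq, create_wedge, wedgeSign_insert, h, h.ne, h.ne', h.le, smul_smul, mul_comm,
        Finset.insert_comm p q]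

theorem annihilate_mul_create_self (p : ℕ) :
    annihilate K p * create K p = 1 - create K p * annihilate K p := by
  refine (wedge K).ext fun S => ?_
  simp only [Module.End.mul_apply, LinearMap.sub_apply, create_wedge, annihilate_wedge]
  by_cases hp : p ∈ S
  · simp [hp, create_wedge, wedgeSign_erase, smul_smul, wedgeSign_mul_self]
  · simp [hp, annihilate_wedge, wedgeSign_insert, smul_smul, wedgeSign_mul_self]

theorem annihilate_mul_create_of_ne {p q : ℕ} (hpq : p ≠ q) :
    annihilate K p * create K q = -(create K q * annihilate K p) := by
  refine (wedge K).ext fun S => ?_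
  simp only [Module.End.mul_apply, LinearMap.neg_apply, create_wedge, annihilate_wedge]
  by_cases hp : p ∈ S <;> by_cases hq : q ∈ S
  · simp [hp, hq, hpq.symm, create_wedge]
  · have he : (insert q S).erase p = insert q (S.erase p) := Finset.erase_insert_of_ne hpq.symm
    rcases lt_or_gt_of_ne hpq with h | h <;>
      simp [hp, hq, create_wedge, annihilate_wedge, wedgeSign_insert, wedgeSign_erase, he, h, h.le,
        smul_smul, mul_comm]
  · simp [hp, hq]
  · simp [hp, hq, hpq, annihilate_wedge]

theorem create_wedge_of_subset_range {p : ℕ} {S : Finset ℕ} (hS : S ⊆ Finset.range p) :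
    create K p (wedge K S) = wedge K (insert p S) := by
  have hp : p ∉ S := fun h => Finset.notMem_range_self (hS h)
  have hmax : S.filter (p < ·) = ∅ :=
    Finset.filter_eq_empty_iff.2 fun q hq => (Finset.mem_range.1 (hS hq)).le.not_gt
  rw [create_wedge, if_neg hp, wedgeSign, hmax, Finset.card_empty, pow_zero, one_smul]

/-- Wedge product with an arbitrary vector of the one-particle space. -/
def wedgeMul (K : Type*) [Field K] : (ℕ →₀ K) →ₗ[K] Module.End K (FinWedge K) :=
  Finsupp.linearCombination K (create K)

theorem wedgeMul_mode (p : ℕ) : wedgeMul K (mode K p) = create K p := by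
  rw [wedgeMul, Finsupp.linearCombination_single, one_smul]

theorem wedgeMul_mul (u v : ℕ →₀ K) :
    wedgeMul K u * wedgeMul K v = -(wedgeMul K v * wedgeMul K u) := by
  induction u using Finsupp.induction_linear with
  | zero => simp
  | add u₁ u₂ h₁ h₂ => rw [map_add, add_mul, mul_add, h₁, h₂, neg_add]
  | single p a =>
    induction v using Finsupp.induction_linear with
    | zero => simp
    | add v₁ v₂ h₁ h₂ => rw [map_add, add_mul, mul_add, h₁, h₂, neg_add]
    | single q b =>
      simp only [wedgeMul, Finsupp.linearCombination_single, smul_mul_smul_comm,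
        create_mul_create p q, smul_neg, mul_comm a b]

theorem wedgeMul_mul_self (u : ℕ →₀ K) : wedgeMul K u * wedgeMul K u = 0 := by
  induction u using Finsupp.induction_linear with
  | zero => rw [map_zero, mul_zero]
  | add u v hu hv =>
    rw [map_add, add_mul, mul_add, mul_add, hu, hv, wedgeMul_mul v u, zero_add, add_zero,
      add_neg_cancel]
  | single p a =>
    rw [wedgeMul, Finsupp.linearCombination_single, smul_mul_smul_comm, create_mul_self, smul_zero]

end FinWedge

open Finset.HasAntidiagonal (antidiagonal mem_antidiagonal)

section FinWedge

variable {K : Type*} [Field K]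

/-- The derivation of the exterior algebra which extends an endomorphism `A` of the one-particle
space, usually denoted by `dΓ(A)`. -/
def secondQuantize (A : Module.End K (ℕ →₀ K)) : Module.End K (FinWedge K) :=
  (wedge K).constr K fun S => ∑ p ∈ S, wedgeMul K (A (mode K p)) (annihilate K p (wedge K S))

theorem secondQuantize_wedge (A : Module.End K (ℕ →₀ K)) (S : Finset ℕ) :
    secondQuantize A (wedge K S) =
      ∑ p ∈ S, wedgeMul K (A (mode K p)) (annihilate K p (wedge K S)) :=
  (wedge K).constr_basis K _ S

theorem secondQuantize_wedge_empty (A : Module.End K (ℕ →₀ K)) :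
    secondQuantize A (wedge K ∅) = 0 := by
  rw [secondQuantize_wedge, Finset.sum_empty]

theorem secondQuantize_wedge_of_subset (A : Module.End K (ℕ →₀ K)) {S T : Finset ℕ} (h : S ⊆ T) :
    secondQuantize A (wedge K S) =
      (∑ p ∈ T, wedgeMul K (A (mode K p)) * annihilate K p) (wedge K S) := by
  rw [secondQuantize_wedge, LinearMap.sum_apply]
  refine Finset.sum_subset h fun p _ hp => ?_
  rw [annihilate_wedge, if_neg hp, map_zero]

theorem sum_wedgeMul_mul_annihilate_mul_create (A : Module.End K (ℕ →₀ K)) {T : Finset ℕ} {q : ℕ}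
    (hq : q ∈ T) :
    (∑ p ∈ T, wedgeMul K (A (mode K p)) * annihilate K p) * create K q =
      create K q * (∑ p ∈ T, wedgeMul K (A (mode K p)) * annihilate K p) +
        wedgeMul K (A (mode K q)) := by
  have pass_create (p : ℕ) : wedgeMul K (A (mode K p)) * annihilate K p * create K q =
      create K q * (wedgeMul K (A (mode K p)) * annihilate K p) +
        if p = q then wedgeMul K (A (mode K p)) else 0 := by
    rw [← wedgeMul_mode q, ← mul_assoc (wedgeMul K (mode K q)), wedgeMul_mul (mode K q), mul_assoc,
      wedgeMul_mode q]
    split_ifs with hpq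
    · rw [hpq, annihilate_mul_create_self, mul_sub, mul_one, ← mul_assoc, neg_mul, neg_add_eq_sub]
    · rw [annihilate_mul_create_of_ne hpq, mul_neg, add_zero, neg_mul, ← mul_assoc]
  simp only [Finset.sum_mul, Finset.mul_sum, pass_create, Finset.sum_add_distrib,
    Finset.sum_ite_eq', if_pos hq]

theorem secondQuantize_mul_create (A : Module.End K (ℕ →₀ K)) (q : ℕ) :
    secondQuantize A * create K q =
      create K q * secondQuantize A + wedgeMul K (A (mode K q)) := by
  refine (wedge K).ext fun S => ?_
  have h := LinearMap.congr_fun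
    (sum_wedgeMul_mul_annihilate_mul_create A (Finset.mem_insert_self q S)) (wedge K S)
  simp only [LinearMap.add_apply, Module.End.mul_apply] at h ⊢
  rw [secondQuantize_wedge_of_subset A (Finset.subset_insert q S), ← h, create_wedge]
  split_ifs
  · simp only [map_zero]
  · rw [map_smul, map_smul, ← secondQuantize_wedge_of_subset A subset_rfl]

theorem secondQuantize_mul_wedgeMul (A : Module.End K (ℕ →₀ K)) (u : ℕ →₀ K) :
    secondQuantize A * wedgeMul K u = wedgeMul K u * secondQuantize A + wedgeMul K (A u) := by
  induction u using Finsupp.induction_linear with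
  | zero => simp only [map_zero, mul_zero, zero_mul, add_zero]
  | add u v hu hv => simp only [map_add, mul_add, add_mul, hu, hv]; abel
  | single q a =>
    rw [← Finsupp.smul_single_one, map_smul, map_smul, map_smul, wedgeMul_mode, mul_smul_comm,
      smul_mul_assoc, secondQuantize_mul_create, smul_add]

theorem secondQuantize_pow_mul_wedgeMul (A : Module.End K (ℕ →₀ K)) (u : ℕ →₀ K) (m : ℕ) :
    secondQuantize A ^ m * wedgeMul K u = ∑ ij ∈ antidiagonal m,
      m.choose ij.1 • (wedgeMul K ((A ^ ij.1) u) * secondQuantize A ^ ij.2) := by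
  induction m with
  | zero => simp
  | succ m ih =>
    rw [Finset.sum_antidiagonal_choose_succ_nsmul
      fun i j => wedgeMul K ((A ^ i) u) * secondQuantize A ^ j]
    rw [pow_succ', mul_assoc, ih, Finset.mul_sum, ← Finset.sum_add_distrib]
    refine Finset.sum_congr rfl fun ij hij => ?_
    rw [Nat.choose_symm_of_eq_add (mem_antidiagonal.1 hij).symm, ← smul_add, mul_smul_comm,
      ← mul_assoc, secondQuantize_mul_wedgeMul, add_mul, mul_assoc, ← pow_succ', pow_succ' A,
      Module.End.mul_apply]

end FinWedge

/-! ### Exponentials of locally nilpotent endomorphisms -/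

section Exponential

variable {K V : Type*} [Field K] [AddCommMonoid V] [Module K V]

/-- An endomorphism is locally nilpotent if each vector is killed by some power of it. -/
def IsLocallyNilpotent (A : Module.End K V) : Prop := ∀ v, ∃ n, (A ^ n) v = 0

theorem pow_apply_eq_zero_of_le {A : Module.End K V} {v : V} {m n : ℕ} (h : (A ^ n) v = 0)
    (hnm : n ≤ m) : (A ^ m) v = 0 := by
  rw [← Nat.sub_add_cancel hnm, pow_add, Module.End.mul_apply, h, map_zero]

theorem isLocallyNilpotent_of_basis {ι : Type*} (b : Module.Basis ι K V) {A : Module.End K V}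
    (h : ∀ i, ∃ n, (A ^ n) (b i) = 0) : IsLocallyNilpotent A := fun v => by
  induction b.mem_span v using Submodule.span_induction with
  | mem v hv => obtain ⟨i, rfl⟩ := hv; exact h i
  | zero => exact ⟨0, map_zero _⟩
  | add v w _ _ hv hw =>
    obtain ⟨⟨m, hm⟩, n, hn⟩ := hv, hw
    refine ⟨m + n, ?_⟩
    rw [map_add, pow_apply_eq_zero_of_le hm (Nat.le_add_right m n),
      pow_apply_eq_zero_of_le hn (Nat.le_add_left n m), add_zero]
  | smul a v _ hv => obtain ⟨n, hn⟩ := hv; exact ⟨n, by rw [map_smul, hn, smul_zero]⟩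

theorem support_expTerm_subset {A : Module.End K V} {v : V} {n : ℕ} (h : (A ^ n) v = 0) :
    Function.support (fun m => (m.factorial : K)⁻¹ • (A ^ m) v) ⊆ Finset.range n := by
  intro m hm
  by_contra hmn
  rw [Finset.coe_range, Set.mem_Iio, not_lt] at hmn
  exact hm (by simp only [pow_apply_eq_zero_of_le h hmn, smul_zero])

theorem IsLocallyNilpotent.hasFiniteSupport_expTerm {A : Module.End K V}
    (hA : IsLocallyNilpotent A) (v : V) :
    Function.HasFiniteSupport fun m => (m.factorial : K)⁻¹ • (A ^ m) v :=
  let ⟨_, hn⟩ := hA v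
  (Finset.finite_toSet _).subset (support_expTerm_subset hn)

/-- The exponential `∑_m A ^ m / m!` of a locally nilpotent endomorphism. -/
def expEnd (A : Module.End K V) (hA : IsLocallyNilpotent A) : Module.End K V where
  toFun v := ∑ᶠ m : ℕ, (m.factorial : K)⁻¹ • (A ^ m) v
  map_add' v w := by
    simp only [map_add, smul_add]
    exact finsum_add_distrib (hA.hasFiniteSupport_expTerm v) (hA.hasFiniteSupport_expTerm w)
  map_smul' a v := by
    simp only [map_smul, smul_comm _ a]
    exact (smul_finsum' a (hA.hasFiniteSupport_expTerm v)).symm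

theorem expEnd_apply {A : Module.End K V} (hA : IsLocallyNilpotent A) (v : V) :
    expEnd A hA v = ∑ᶠ m : ℕ, (m.factorial : K)⁻¹ • (A ^ m) v := rfl

theorem expEnd_apply_eq_sum {A : Module.End K V} (hA : IsLocallyNilpotent A) {v : V} {n : ℕ}
    (h : (A ^ n) v = 0) :
    expEnd A hA v = ∑ m ∈ Finset.range n, (m.factorial : K)⁻¹ • (A ^ m) v :=
  finsum_eq_sum_of_support_subset _ (support_expTerm_subset h)

theorem expEnd_apply_of_map_eq_zero {A : Module.End K V} (hA : IsLocallyNilpotent A) {v : V}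
    (h : A v = 0) : expEnd A hA v = v := by
  rw [expEnd_apply_eq_sum hA (n := 1) (by rwa [pow_one])]
  simp

theorem expEnd_mem {A : Module.End K V} (hA : IsLocallyNilpotent A) {E : Submodule K V}
    (h : ∀ v ∈ E, A v ∈ E) {v : V} (hv : v ∈ E) : expEnd A hA v ∈ E := by
  obtain ⟨n, hn⟩ := hA v
  rw [expEnd_apply_eq_sum hA hn]
  exact Submodule.sum_mem _ fun m _ =>
    Submodule.smul_mem _ _ (Module.End.pow_apply A m v ▸ Set.MapsTo.iterate h m hv)

theorem sum_antidiagonal_eq_sum_range {M N : ℕ} {c : ℕ → ℕ → V}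
    (hM : ∀ i j, M ≤ i → c i j = 0) (hN : ∀ i j, N ≤ j → c i j = 0) :
    ∑ m ∈ Finset.range (M + N), ∑ ij ∈ antidiagonal m, c ij.1 ij.2 =
      ∑ i ∈ Finset.range M, ∑ j ∈ Finset.range N, c i j := by
  have hmaps : ∀ ij ∈ Finset.range M ×ˢ Finset.range N, ij.1 + ij.2 ∈ Finset.range (M + N) := by
    simp only [Finset.mem_product, Finset.mem_range]
    omega
  rw [← Finset.sum_product', ← Finset.sum_fiberwise_of_maps_to hmaps]
  refine Finset.sum_congr rfl fun m _ => (Finset.sum_subset ?_ fun ij hij hij' => ?_).symm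
  · intro ij hij
    exact mem_antidiagonal.2 (Finset.mem_filter.1 hij).2
  · rw [mem_antidiagonal] at hij
    simp only [Finset.mem_filter, Finset.mem_product, Finset.mem_range, hij, and_true,
      not_and_or, not_lt] at hij'
    exact hij'.elim (hM _ _) (hN _ _)

end Exponential

section FinWedge

variable {K : Type*} [Field K]

theorem secondQuantize_pow_wedgeMul_eq_zero {A : Module.End K (ℕ →₀ K)} {u : ℕ →₀ K}
    {v : FinWedge K} {M N : ℕ} (hM : (A ^ M) u = 0) (hN : (secondQuantize A ^ N) v = 0) :
    (secondQuantize A ^ (M + N)) (wedgeMul K u v) = 0 := by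
  rw [← Module.End.mul_apply, secondQuantize_pow_mul_wedgeMul, LinearMap.sum_apply]
  refine Finset.sum_eq_zero fun ij hij => ?_
  rw [LinearMap.smul_apply, Module.End.mul_apply]
  rcases le_or_gt M ij.1 with h | h
  · rw [pow_apply_eq_zero_of_le hM h, map_zero, LinearMap.zero_apply, smul_zero]
  · have hj : N ≤ ij.2 := by rw [mem_antidiagonal] at hij; omega
    rw [pow_apply_eq_zero_of_le hN hj, map_zero, smul_zero]

theorem IsLocallyNilpotent.secondQuantize {A : Module.End K (ℕ →₀ K)}
    (hA : IsLocallyNilpotent A) : IsLocallyNilpotent (secondQuantize A) := by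
  refine isLocallyNilpotent_of_basis (wedge K) fun S => ?_
  induction S using Finset.induction_on_max with
  | empty => exact ⟨1, by rw [pow_one, secondQuantize_wedge_empty]⟩
  | insert p S hp ih =>
    obtain ⟨⟨n, hn⟩, m, hm⟩ := And.intro ih (hA (mode K p))
    rw [← create_wedge_of_subset_range fun q hq => Finset.mem_range.2 (hp q hq), ← wedgeMul_mode]
    exact ⟨m + n, secondQuantize_pow_wedgeMul_eq_zero hm hn⟩

theorem inv_factorial_smul_secondQuantize_pow [CharZero K] (A : Module.End K (ℕ →₀ K))
    (u : ℕ →₀ K) (v : FinWedge K) (m : ℕ) :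
    (m.factorial : K)⁻¹ • (secondQuantize A ^ m) (wedgeMul K u v) =
      ∑ ij ∈ antidiagonal m, wedgeMul K ((ij.1.factorial : K)⁻¹ • (A ^ ij.1) u)
        ((ij.2.factorial : K)⁻¹ • (secondQuantize A ^ ij.2) v) := by
  rw [← Module.End.mul_apply, secondQuantize_pow_mul_wedgeMul, LinearMap.sum_apply,
    Finset.smul_sum]
  refine Finset.sum_congr rfl fun ij hij => ?_
  obtain rfl := mem_antidiagonal.1 hij
  have hfactorial : ((ij.1 + ij.2).factorial : K) ≠ 0 :=
    Nat.cast_ne_zero.2 (Nat.factorial_ne_zero _)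
  simp only [LinearMap.smul_apply, Module.End.mul_apply, map_smul, smul_smul,
    ← Nat.cast_smul_eq_nsmul K, Nat.cast_add_choose]
  congr 1
  field_simp

theorem expEnd_secondQuantize_mul_wedgeMul [CharZero K] {A : Module.End K (ℕ →₀ K)}
    (hA : IsLocallyNilpotent A) (u : ℕ →₀ K) :
    expEnd _ hA.secondQuantize * wedgeMul K u =
      wedgeMul K (expEnd A hA u) * expEnd _ hA.secondQuantize := by
  refine LinearMap.ext fun v => ?_
  obtain ⟨⟨M, hM⟩, N, hN⟩ := And.intro (hA u) (hA.secondQuantize v)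
  rw [Module.End.mul_apply, Module.End.mul_apply,
    expEnd_apply_eq_sum _ (secondQuantize_pow_wedgeMul_eq_zero hM hN),
    expEnd_apply_eq_sum _ hM, expEnd_apply_eq_sum _ hN,
    Finset.sum_congr rfl fun m _ => inv_factorial_smul_secondQuantize_pow A u v m,
    sum_antidiagonal_eq_sum_range (c := fun i j => wedgeMul K ((i.factorial : K)⁻¹ • (A ^ i) u)
      ((j.factorial : K)⁻¹ • (secondQuantize A ^ j) v))
      (fun i j h => by
        simp only [pow_apply_eq_zero_of_le hM h, smul_zero, map_zero, LinearMap.zero_apply])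
      (fun i j h => by simp only [pow_apply_eq_zero_of_le hN h, smul_zero, map_zero])]
  simp only [map_sum, LinearMap.sum_apply]
  exact Finset.sum_comm

end FinWedge

/-! ### Intertwiners -/

section Intertwiner

variable {K : Type*} [Field K]

/-- `T` fixes the empty wedge and carries the wedge product with `A u` to that with `B u`. If `A` is
invertible, then `T` is the algebra endomorphism `Γ(B A⁻¹)` of the exterior algebra. -/
structure Intertwines (A B : Module.End K (ℕ →₀ K)) (T : Module.End K (FinWedge K)) : Prop where
  map_empty : T (wedge K ∅) = wedge K ∅
  mul_wedgeMul : ∀ u, T * wedgeMul K (A u) = wedgeMul K (B u) * T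

theorem intertwines_one (A : Module.End K (ℕ →₀ K)) : Intertwines A A 1 :=
  ⟨rfl, fun _ => by rw [one_mul, mul_one]⟩

theorem Intertwines.mul {A B C : Module.End K (ℕ →₀ K)} {T U : Module.End K (FinWedge K)}
    (hT : Intertwines B C T) (hU : Intertwines A B U) : Intertwines A C (T * U) where
  map_empty := by rw [Module.End.mul_apply, hU.map_empty, hT.map_empty]
  mul_wedgeMul u := by rw [mul_assoc, hU.mul_wedgeMul, ← mul_assoc, hT.mul_wedgeMul, mul_assoc]

theorem Intertwines.comp_right {A B : Module.End K (ℕ →₀ K)} {T : Module.End K (FinWedge K)}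
    (hT : Intertwines A B T) (C : Module.End K (ℕ →₀ K)) : Intertwines (A * C) (B * C) T :=
  ⟨hT.map_empty, fun u => hT.mul_wedgeMul (C u)⟩

theorem Intertwines.unique {A B : Module.End K (ℕ →₀ K)} {T U : Module.End K (FinWedge K)}
    (hA : Function.Surjective A) (hT : Intertwines A B T) (hU : Intertwines A B U) : T = U := by
  refine (wedge K).ext fun S => ?_
  induction S using Finset.induction_on_max with
  | empty => rw [hT.map_empty, hU.map_empty]
  | insert p S hp ih =>
    obtain ⟨u, hu⟩ := hA (mode K p)
    rw [← create_wedge_of_subset_range fun q hq => Finset.mem_range.2 (hp q hq), ← wedgeMul_mode,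
      ← hu, ← Module.End.mul_apply, ← Module.End.mul_apply, hT.mul_wedgeMul, hU.mul_wedgeMul,
      Module.End.mul_apply, Module.End.mul_apply, ih]

/-- The span of the wedges on `v_0, …, v_{n-1}`. -/
def wedgesBelow (K : Type*) [Field K] (n : ℕ) : Submodule K (FinWedge K) :=
  Submodule.span K (wedge K '' {S | S ⊆ Finset.range n})

theorem wedge_mem_wedgesBelow {n : ℕ} {S : Finset ℕ} (hS : S ⊆ Finset.range n) :
    wedge K S ∈ wedgesBelow K n :=
  Submodule.subset_span ⟨S, hS, rfl⟩

theorem wedgeMul_mem_wedgesBelow {n : ℕ} {u : ℕ →₀ K} (hu : u ∈ Finsupp.supported K K (Set.Iio n))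
    {w : FinWedge K} (hw : w ∈ wedgesBelow K n) : wedgeMul K u w ∈ wedgesBelow K n := by
  rw [wedgeMul, Finsupp.linearCombination_apply, Finsupp.sum, LinearMap.sum_apply]
  refine Submodule.sum_mem _ fun p hp => Submodule.smul_mem _ _ ?_
  have hpn : p < n := (Finsupp.mem_supported K u).1 hu hp
  induction hw using Submodule.span_induction with
  | mem w hw =>
    obtain ⟨S, hS, rfl⟩ := hw
    rw [create_wedge]
    split_ifs
    · exact zero_mem _
    · exact Submodule.smul_mem _ _ (wedge_mem_wedgesBelow
        (Finset.insert_subset (Finset.mem_range.2 hpn) hS))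
  | zero => rw [map_zero]; exact zero_mem _
  | add v w _ _ hv hw => rw [map_add]; exact add_mem hv hw
  | smul a w _ hw => rw [map_smul]; exact Submodule.smul_mem _ _ hw

theorem wedgesBelow_induction {P : FinWedge K → Prop} {u : ℕ → ℕ →₀ K}
    (hu : ∀ n, u n - mode K n ∈ Finsupp.supported K K (Set.Iio n)) {n : ℕ}
    (below : ∀ w ∈ wedgesBelow K n, P w)
    (wedgeMul_below : ∀ S ⊆ Finset.range n, P (wedgeMul K (u n) (wedge K S)))
    (add : ∀ v w, P v → P w → P (v + w)) (smul : ∀ (a : K) w, P w → P (a • w)) :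
    ∀ w ∈ wedgesBelow K (n + 1), P w := by
  intro w hw
  induction hw using Submodule.span_induction with
  | mem w hw =>
    obtain ⟨S, hS, rfl⟩ := hw
    by_cases hn : n ∈ S
    · have herase : S.erase n ⊆ Finset.range n := by
        rw [Finset.range_add_one] at hS
        exact Finset.subset_insert_iff.1 hS
      have hsplit : wedge K S = wedgeMul K (u n) (wedge K (S.erase n)) +
          (-1 : K) • wedgeMul K (u n - mode K n) (wedge K (S.erase n)) := by
        rw [map_sub, LinearMap.sub_apply, wedgeMul_mode, create_wedge_of_subset_range herase,
          Finset.insert_erase hn]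
        module
      rw [hsplit]
      exact add _ _ (wedgeMul_below _ herase) (smul _ _ (below _
        (wedgeMul_mem_wedgesBelow (hu n) (wedge_mem_wedgesBelow herase))))
    · refine below _ (wedge_mem_wedgesBelow fun p hp => ?_)
      have hpn := Finset.mem_range.1 (hS hp)
      have hne : p ≠ n := fun h => hn (h ▸ hp)
      rw [Finset.mem_range]
      omega
  | zero => exact below 0 (zero_mem _)
  | add v w _ _ hv hw => exact add v w hv hw
  | smul a w _ hw => exact smul a w hw

theorem wedgeMul_mode_mem_wedgesBelow {A : Module.End K (ℕ →₀ K)}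
    (hA : ∀ p, A (mode K p) - mode K p ∈ Finsupp.supported K K (Set.Iio p)) {p n : ℕ} (hpn : p < n)
    {w : FinWedge K} (hw : w ∈ wedgesBelow K n) :
    wedgeMul K (A (mode K p)) w ∈ wedgesBelow K n := by
  refine wedgeMul_mem_wedgesBelow ?_ hw
  rw [← sub_add_cancel (A (mode K p)) (mode K p)]
  exact add_mem (Finsupp.supported_mono (Set.Iio_subset_Iio hpn.le) (hA p))
    (Finsupp.single_mem_supported K 1 hpn)

theorem Intertwines.of_mode {A B : Module.End K (ℕ →₀ K)} {T : Module.End K (FinWedge K)}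
    (map_empty : T (wedge K ∅) = wedge K ∅)
    (map_wedgeMul : ∀ p S, T (wedgeMul K (A (mode K p)) (wedge K S)) =
      wedgeMul K (B (mode K p)) (T (wedge K S))) : Intertwines A B T := by
  refine ⟨map_empty, fun u => ?_⟩
  induction u using Finsupp.induction_linear with
  | zero => simp only [map_zero, mul_zero, zero_mul]
  | add u v hu hv => simp only [map_add, mul_add, add_mul, hu, hv]
  | single p a =>
    refine (wedge K).ext fun S => ?_
    rw [← Finsupp.smul_single_one]
    simp only [map_smul, Module.End.mul_apply, LinearMap.smul_apply, map_wedgeMul]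

/-- For unitriangular `A` it suffices to check the exchange relation on wedges lying below the
created mode: the remaining cases follow by anticommuting. -/
theorem Intertwines.of_subset_range {A B : Module.End K (ℕ →₀ K)}
    {T : Module.End K (FinWedge K)}
    (hA : ∀ p, A (mode K p) - mode K p ∈ Finsupp.supported K K (Set.Iio p))
    (map_empty : T (wedge K ∅) = wedge K ∅)
    (map_wedgeMul : ∀ p, ∀ S ⊆ Finset.range p, T (wedgeMul K (A (mode K p)) (wedge K S)) =
      wedgeMul K (B (mode K p)) (T (wedge K S))) : Intertwines A B T := by
  have anticomm (u v : ℕ →₀ K) (w : FinWedge K) :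
      wedgeMul K u (wedgeMul K v w) = -wedgeMul K v (wedgeMul K u w) :=
    LinearMap.congr_fun (wedgeMul_mul u v) w
  have square_zero (u : ℕ →₀ K) (w : FinWedge K) : wedgeMul K u (wedgeMul K u w) = 0 :=
    LinearMap.congr_fun (wedgeMul_mul_self u) w
  have exchange_above {n p : ℕ} (hnp : n ≤ p) {w : FinWedge K} (hw : w ∈ wedgesBelow K n) :
      T (wedgeMul K (A (mode K p)) w) = wedgeMul K (B (mode K p)) (T w) :=
    LinearMap.eqOn_span (f := T * wedgeMul K (A (mode K p))) (g := wedgeMul K (B (mode K p)) * T)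
      (by
        rintro _ ⟨S, hS, rfl⟩
        exact map_wedgeMul p S (hS.trans (Finset.range_subset_range.2 hnp))) hw
  have exchange (n : ℕ) : ∀ w ∈ wedgesBelow K n, ∀ p,
      T (wedgeMul K (A (mode K p)) w) = wedgeMul K (B (mode K p)) (T w) := by
    induction n with
    | zero => exact fun w hw p => exchange_above (Nat.zero_le p) hw
    | succ n ih =>
      intro w hw p
      rcases lt_or_ge n p with hnp | hpn
      · exact exchange_above hnp hw
      · refine wedgesBelow_induction hA (fun w hw => ih w hw p) (fun S hS => ?_)
          (fun v w hv hw => by rw [map_add, map_add, map_add, map_add, hv, hw])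
          (fun a w hw => by rw [map_smul, map_smul, map_smul, map_smul, hw]) w hw
        rcases hpn.eq_or_lt with rfl | hpn
        · rw [square_zero, map_zero, map_wedgeMul p S hS, square_zero]
        · have hS := wedge_mem_wedgesBelow (K := K) hS
          rw [anticomm, map_neg,
            exchange_above le_rfl (wedgeMul_mode_mem_wedgesBelow hA hpn hS), ih _ hS, anticomm,
            neg_neg, exchange_above le_rfl hS]
  refine .of_mode map_empty fun p S => ?_
  obtain ⟨n, hn⟩ := Finset.exists_nat_subset_range S
  exact exchange n _ (wedge_mem_wedgesBelow hn) p

end Intertwiner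

/-! ### Power series in the shift -/

section ShiftAction

variable {K : Type*} [Field K]

/-- The linear map underlying `shiftAct`. -/
def shiftActLinear (K : Type*) [Field K] : PowerSeries K →ₗ[K] Module.End K (ℕ →₀ K) :=
  LinearMap.flip <| Finsupp.linearCombination K fun p =>
    ∑ kl ∈ antidiagonal p, (PowerSeries.coeff kl.1).smulRight (mode K kl.2)

theorem shiftActLinear_mode (f : PowerSeries K) (p : ℕ) : shiftActLinear K f (mode K p) =
    ∑ kl ∈ antidiagonal p, PowerSeries.coeff kl.1 f • mode K kl.2 := by
  simp [shiftActLinear]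

theorem shiftActLinear_mode_apply (f : PowerSeries K) (p l : ℕ) :
    shiftActLinear K f (mode K p) l = PowerSeries.coeff p (f * PowerSeries.X ^ l) := by
  simp [shiftActLinear_mode, PowerSeries.coeff_mul, PowerSeries.coeff_X_pow,
    Finsupp.single_apply, Finsupp.finsetSum_apply, eq_comm]

/-- The action of power series on the one-particle space in which `X` is the shift
`v_p ↦ v_{p-1}`, where `v_{-1} = 0`. -/
def shiftAct (K : Type*) [Field K] : PowerSeries K →ₐ[K] Module.End K (ℕ →₀ K) :=
  AlgHom.ofLinearMap (shiftActLinear K)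
    (by
      ext p l
      simp [shiftActLinear_mode_apply, PowerSeries.coeff_X_pow, Finsupp.single_apply])
    (fun f g => by
      ext p l
      change shiftActLinear K (f * g) (mode K p) l =
        shiftActLinear K f (shiftActLinear K g (mode K p)) l
      rw [shiftActLinear_mode g, map_sum, Finsupp.finsetSum_apply, shiftActLinear_mode_apply,
        mul_comm f, mul_assoc, PowerSeries.coeff_mul]
      refine Finset.sum_congr rfl fun kl _ => ?_
      rw [map_smul, Finsupp.smul_apply, shiftActLinear_mode_apply, smul_eq_mul])

theorem shiftAct_mode (f : PowerSeries K) (p : ℕ) : shiftAct K f (mode K p) =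
    ∑ kl ∈ antidiagonal p, PowerSeries.coeff kl.1 f • mode K kl.2 :=
  shiftActLinear_mode f p

theorem shiftAct_mode_apply (f : PowerSeries K) (p l : ℕ) :
    shiftAct K f (mode K p) l = PowerSeries.coeff p (f * PowerSeries.X ^ l) :=
  shiftActLinear_mode_apply f p l

theorem shiftAct_X_pow_mode (k p : ℕ) :
    shiftAct K (PowerSeries.X ^ k) (mode K p) = if k ≤ p then mode K (p - k) else 0 := by
  ext l
  rw [shiftAct_mode_apply, ← pow_add, PowerSeries.coeff_X_pow]
  split_ifs with h₁ h₂ h₂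
  · rw [Finsupp.single_apply, if_pos (by omega)]
  · omega
  · rw [Finsupp.single_apply, if_neg (by omega)]
  · rfl

theorem shiftAct_X_mode_zero : shiftAct K PowerSeries.X (mode K 0) = 0 := by
  rw [← pow_one PowerSeries.X, shiftAct_X_pow_mode, if_neg (by omega)]

theorem shiftAct_X_mode_succ (p : ℕ) :
    shiftAct K PowerSeries.X (mode K (p + 1)) = mode K p := by
  rw [← pow_one PowerSeries.X, shiftAct_X_pow_mode, if_pos (by omega), Nat.add_sub_cancel]

theorem shiftAct_mode_eq_zero {f : PowerSeries K} {p : ℕ} (hf : PowerSeries.X ^ (p + 1) ∣ f) :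
    shiftAct K f (mode K p) = 0 := by
  rw [PowerSeries.X_pow_dvd_iff] at hf
  rw [shiftAct_mode]
  refine Finset.sum_eq_zero fun kl hkl => ?_
  rw [hf kl.1 (Finset.Nat.antidiagonal.fst_lt hkl), zero_smul]

theorem shiftAct_pow_mode_eq_zero {h : PowerSeries K} (hh : h.constantCoeff = 0) (p : ℕ) :
    (shiftAct K h ^ (p + 1)) (mode K p) = 0 := by
  rw [← map_pow]
  exact shiftAct_mode_eq_zero (pow_dvd_pow_of_dvd (PowerSeries.X_dvd_iff.2 hh) _)

theorem isLocallyNilpotent_shiftAct {h : PowerSeries K} (hh : h.constantCoeff = 0) :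
    IsLocallyNilpotent (shiftAct K h) :=
  isLocallyNilpotent_of_basis Finsupp.basisSingleOne fun p =>
    ⟨p + 1, by rw [Finsupp.coe_basisSingleOne, shiftAct_pow_mode_eq_zero hh]⟩

theorem surjective_shiftAct {f : PowerSeries K} (hf : f.constantCoeff ≠ 0) :
    Function.Surjective (shiftAct K f) := fun u =>
  ⟨shiftAct K f⁻¹ u, by
    rw [← Module.End.mul_apply, ← map_mul, PowerSeries.mul_inv_cancel f hf, map_one,
      Module.End.one_apply]⟩

/-- The exponential `e^h` of a power series without constant term. -/
abbrev expSeries [CharZero K] (h : PowerSeries K) : PowerSeries K := (PowerSeries.exp K).subst h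

theorem coeff_expSeries [CharZero K] {h : PowerSeries K} (hh : h.constantCoeff = 0) {n N : ℕ}
    (hnN : n < N) : PowerSeries.coeff n (expSeries h) =
      ∑ m ∈ Finset.range N, (m.factorial : K)⁻¹ * PowerSeries.coeff n (h ^ m) := by
  rw [PowerSeries.coeff_subst' (PowerSeries.HasSubst.of_constantCoeff_zero' hh),
    finsum_eq_sum_of_support_subset (s := Finset.range N)]
  · simp [PowerSeries.coeff_exp]
  · intro m hm
    by_contra hmN
    rw [Finset.coe_range, Set.mem_Iio, not_lt] at hmN
    have hdvd := pow_dvd_pow_of_dvd (PowerSeries.X_dvd_iff.2 hh) m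
    exact hm (by
      simp only [PowerSeries.X_pow_dvd_iff.1 hdvd n (hnN.trans_le hmN), smul_zero])

theorem expEnd_shiftAct [CharZero K] {h : PowerSeries K} (hh : h.constantCoeff = 0) :
    expEnd (shiftAct K h) (isLocallyNilpotent_shiftAct hh) = shiftAct K (expSeries h) := by
  refine Finsupp.basisSingleOne.ext fun p => Finsupp.ext fun l => ?_
  rw [Finsupp.coe_basisSingleOne, expEnd_apply_eq_sum _ (shiftAct_pow_mode_eq_zero hh p),
    shiftAct_mode_apply, Finsupp.finsetSum_apply, PowerSeries.coeff_mul_X_pow',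
    coeff_expSeries hh (Nat.lt_succ_of_le (Nat.sub_le p l))]
  simp only [Finsupp.smul_apply, ← map_pow, shiftAct_mode_apply, PowerSeries.coeff_mul_X_pow',
    smul_eq_mul]
  split_ifs
  · rfl
  · simp only [mul_zero, Finset.sum_const_zero]

end ShiftAction

/-! ### Exponential power series -/

section ExpSeries

variable {K : Type*} [Field K]

/-- The generating series `∑_{k ≥ 1} t_k X ^ k`. -/
def currentSeries (t : ℕ+ → K) : PowerSeries K :=
  PowerSeries.mk fun k => if hk : 0 < k then t ⟨k, hk⟩ else 0

theorem constantCoeff_currentSeries (t : ℕ+ → K) : (currentSeries t).constantCoeff = 0 := by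
  simp [currentSeries]

theorem coeff_succ_currentSeries (t : ℕ+ → K) (k : ℕ) :
    PowerSeries.coeff (k + 1) (currentSeries t) = t k.succPNat := by
  simp [currentSeries, Nat.succPNat]

theorem currentSeries_add (s t : ℕ+ → K) :
    currentSeries (s + t) = currentSeries s + currentSeries t := by
  ext (_ | k)
  · simp [currentSeries]
  · simp only [map_add, coeff_succ_currentSeries, Pi.add_apply]

theorem currentSeries_zero : currentSeries (0 : ℕ+ → K) = 0 := by
  ext (_ | k)
  · simp [currentSeries]
  · simp only [map_zero, coeff_succ_currentSeries, Pi.zero_apply]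

/-- The power sum `p_k` of one ordinary variable `x` and one super variable `y`, divided by `k`. -/
def superPowerSum (x y : K) (k : ℕ+) : K := (x ^ (k : ℕ) + (-1) ^ ((k : ℕ) - 1) * y ^ (k : ℕ)) / k

theorem mk_pow_mul_one_sub (x : K) :
    (PowerSeries.mk fun k => x ^ k) * (1 - PowerSeries.C x * PowerSeries.X) = 1 := by
  ext (_ | k)
  · simp
  · simp [mul_sub, mul_left_comm _ (PowerSeries.C x), ← mul_assoc, PowerSeries.coeff_succ_mul_X,
      PowerSeries.coeff_one, pow_succ']

variable [CharZero K]

theorem constantCoeff_expSeries {h : PowerSeries K} (hh : h.constantCoeff = 0) :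
    (expSeries h).constantCoeff = 1 := by
  rw [← PowerSeries.coeff_zero_eq_constantCoeff_apply, coeff_expSeries hh zero_lt_one]
  simp

theorem derivative_expSeries {h : PowerSeries K} (hh : h.constantCoeff = 0) :
    PowerSeries.derivative K (expSeries h) = expSeries h * PowerSeries.derivative K h := by
  rw [PowerSeries.derivative_subst (PowerSeries.HasSubst.of_constantCoeff_zero' hh),
    PowerSeries.derivative_exp]

theorem eq_of_derivative_mul_eq {f g : PowerSeries K} (hg : g.constantCoeff ≠ 0)
    (hfg : f.constantCoeff = g.constantCoeff)
    (h : PowerSeries.derivative K f * g = f * PowerSeries.derivative K g) : f = g := by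
  have hquot : f * g⁻¹ = 1 := by
    refine PowerSeries.derivative.ext ?_ (by simp [hfg, hg])
    have hcancel := PowerSeries.mul_inv_cancel g hg
    rw [Derivation.leibniz, PowerSeries.derivative_inv', PowerSeries.derivative_one]
    simp only [smul_eq_mul]
    linear_combination g⁻¹ ^ 2 * h - PowerSeries.derivative K f * g⁻¹ * hcancel
  rw [← mul_one f, ← PowerSeries.inv_mul_cancel g hg, ← mul_assoc, hquot, one_mul]

theorem expSeries_zero : expSeries (0 : PowerSeries K) = 1 := by
  simp [PowerSeries.subst_zero_eq_C_constantCoeff]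

theorem expSeries_add {h k : PowerSeries K} (hh : h.constantCoeff = 0)
    (hk : k.constantCoeff = 0) : expSeries (h + k) = expSeries h * expSeries k := by
  have hhk : (h + k).constantCoeff = 0 := by rw [map_add, hh, hk, add_zero]
  have hone : (expSeries h * expSeries k).constantCoeff = 1 := by
    rw [map_mul, constantCoeff_expSeries hh, constantCoeff_expSeries hk, one_mul]
  refine eq_of_derivative_mul_eq (hone.trans_ne one_ne_zero)
    ((constantCoeff_expSeries hhk).trans hone.symm) ?_
  rw [derivative_expSeries hhk, Derivation.leibniz, derivative_expSeries hh,
    derivative_expSeries hk, map_add]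
  simp only [smul_eq_mul]
  ring

theorem derivative_currentSeries_superPowerSum (x y : K) :
    PowerSeries.derivative K (currentSeries (superPowerSum x y)) =
      PowerSeries.C x * (PowerSeries.mk fun k => x ^ k) +
        PowerSeries.C y * PowerSeries.mk fun k => (-y) ^ k := by
  ext k
  have hk : (k : K) + 1 ≠ 0 := k.cast_add_one_ne_zero
  rw [PowerSeries.coeff_derivative, coeff_succ_currentSeries, superPowerSum, Nat.succPNat_coe,
    Nat.succ_eq_add_one, Nat.add_sub_cancel, Nat.cast_add_one, div_mul_cancel₀ _ hk, map_add,
    PowerSeries.coeff_C_mul, PowerSeries.coeff_C_mul, PowerSeries.coeff_mk, PowerSeries.coeff_mk,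
    neg_pow y]
  ring

theorem expSeries_superPowerSum_mul (x y : K) :
    expSeries (currentSeries (superPowerSum x y)) * (1 - PowerSeries.C x * PowerSeries.X) =
      1 + PowerSeries.C y * PowerSeries.X := by
  have hconst := constantCoeff_currentSeries (superPowerSum x y)
  refine eq_of_derivative_mul_eq (by simp) (by simp [constantCoeff_expSeries hconst]) ?_
  have hx := mk_pow_mul_one_sub x
  have hy := mk_pow_mul_one_sub (-y)
  rw [map_neg, neg_mul, sub_neg_eq_add] at hy
  rw [Derivation.leibniz, derivative_expSeries hconst, derivative_currentSeries_superPowerSum]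
  simp only [map_add, map_sub, Derivation.leibniz, PowerSeries.derivative_one,
    PowerSeries.derivative_C, PowerSeries.derivative_X, smul_eq_mul, mul_one, mul_zero,
    add_zero, zero_add, zero_sub]
  linear_combination expSeries (currentSeries (superPowerSum x y)) *
    ((1 + PowerSeries.C y * PowerSeries.X) * PowerSeries.C x * hx +
      (1 - PowerSeries.C x * PowerSeries.X) * PowerSeries.C y * hy)

end ExpSeries

/-! ### The operators `e^{H₊}` on finite wedges -/

section ExpOp

variable {K : Type*} [Field K]

/-- The Hamiltonian `∑_{k ≥ 1} t_k J_k` on finite wedges. -/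
def hamiltonian (t : ℕ+ → K) : Module.End K (FinWedge K) :=
  secondQuantize (shiftAct K (currentSeries t))

theorem isLocallyNilpotent_hamiltonian (t : ℕ+ → K) : IsLocallyNilpotent (hamiltonian t) :=
  (isLocallyNilpotent_shiftAct (constantCoeff_currentSeries t)).secondQuantize

/-- The exponential of the Hamiltonian `∑_{k ≥ 1} t_k J_k` on finite wedges. -/
def expOp (t : ℕ+ → K) : Module.End K (FinWedge K) :=
  expEnd (hamiltonian t) (isLocallyNilpotent_hamiltonian t)

variable [CharZero K]

theorem intertwines_expOp (t : ℕ+ → K) :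
    Intertwines 1 (shiftAct K (expSeries (currentSeries t))) (expOp t) where
  map_empty := expEnd_apply_of_map_eq_zero _ (secondQuantize_wedge_empty _)
  mul_wedgeMul u := by
    rw [← expEnd_shiftAct (constantCoeff_currentSeries t)]
    exact expEnd_secondQuantize_mul_wedgeMul _ u

theorem expOp_zero : expOp (0 : ℕ+ → K) = 1 := by
  have h := intertwines_expOp (0 : ℕ+ → K)
  rw [currentSeries_zero, expSeries_zero, map_one] at h
  exact h.unique Function.surjective_id (intertwines_one 1)

theorem expOp_add (s t : ℕ+ → K) : expOp (s + t) = expOp s * expOp t := by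
  refine (intertwines_expOp (s + t)).unique Function.surjective_id ?_
  rw [currentSeries_add, expSeries_add (constantCoeff_currentSeries s)
    (constantCoeff_currentSeries t), map_mul]
  exact ((intertwines_expOp s).comp_right _).mul (intertwines_expOp t)

theorem Intertwines.eq_expOp_superPowerSum {x y : K} {T : Module.End K (FinWedge K)}
    (hT : Intertwines (shiftAct K (1 - PowerSeries.C x * PowerSeries.X))
      (shiftAct K (1 + PowerSeries.C y * PowerSeries.X)) T) : T = expOp (superPowerSum x y) := by
  refine hT.unique (surjective_shiftAct (by simp)) ?_
  rw [← expSeries_superPowerSum_mul x y, map_mul]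
  have h := (intertwines_expOp (superPowerSum x y)).comp_right
    (shiftAct K (1 - PowerSeries.C x * PowerSeries.X))
  rwa [one_mul] at h

end ExpOp

/-! ### Transfer matrices -/

section Transfer

variable {K : Type*} [Field K]

theorem sum_paths_eq_prod {α : Type*} [Fintype α] [DecidableEq α] (P : ℕ → Matrix α α K) (N : ℕ)
    (a b : α) : ∑ v : Fin (N + 1) → α, (if v 0 = a ∧ v (Fin.last N) = b then
      ∏ i : Fin N, P i (v i.castSucc) (v i.succ) else 0) = ((List.range N).map P).prod a b := by
  induction N generalizing b with
  | zero =>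
    rw [← (Equiv.funUnique (Fin 1) α).symm.sum_comp, Finset.sum_eq_single a]
    · simp [Matrix.one_apply, Equiv.funUnique]
    · simp +contextual [Equiv.funUnique]
    · simp
  | succ N ih =>
    have snoc_zero (c : α) (v : Fin (N + 1) → α) : (Fin.snoc v c : Fin (N + 2) → α) 0 = v 0 :=
      Fin.snoc_castSucc (α := fun _ => α) c v 0
    have snoc_castSucc_succ (c : α) (v : Fin (N + 1) → α) (i : Fin N) :
        (Fin.snoc v c : Fin (N + 2) → α) i.castSucc.succ = v i.succ :=
      Fin.snoc_castSucc (α := fun _ => α) c v i.succ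
    rw [← (Fin.snocEquiv fun _ : Fin (N + 2) => α).sum_comp, Fintype.sum_prod_type,
      List.prod_range_succ, Matrix.mul_apply]
    simp only [Fin.snocEquiv, Equiv.coe_fn_mk, snoc_zero, Fin.snoc_last, Fin.prod_univ_castSucc,
      Fin.snoc_castSucc, snoc_castSucc_succ, Fin.succ_last, Fin.val_castSucc, Fin.val_last, ← ih,
      Finset.sum_mul]
    rw [Finset.sum_eq_single b (fun c _ hc => by simp [hc]) (by simp), Finset.sum_comm]
    refine Finset.sum_congr rfl fun v _ => ?_
    rw [Finset.sum_eq_single (v (Fin.last N)) (fun c _ hc => by simp [Ne.symm hc]) (by simp)]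
    simp [ite_mul]

/-- The spin in column `c` of a row of vertical edges with `-` exactly on `S`. -/
def spin (S : Finset ℕ) (c : ℕ) : Spin := if c ∈ S then Spin.minus else Spin.plus

/-- The partition function of the first `n` columns of a row with bottom spins `lam` and top spins
`mu`, with left boundary spin `+` and spin `s` to the right of these columns. -/
def rowSum (w : Weights K) (lam mu : Finset ℕ) (n : ℕ) : Spin → K :=
  ((List.range n).map fun c => Matrix.of fun l r =>
    w.vertex l (spin mu c) r (spin lam c)).prod Spin.plus

/-- The weight of a row of width `M + 1`, as a function of its vertical spins. -/
def rowMatrix (w : Weights K) (M : ℕ) :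
    Matrix (Fin (M + 1) → Spin) (Fin (M + 1) → Spin) K :=
  Matrix.of fun b t =>
    ∑ h : Fin (M + 2) → Spin, if h 0 = Spin.plus ∧ h (Fin.last (M + 1)) = Spin.plus then
      ∏ c : Fin (M + 1), w.vertex (h c.castSucc) (t c) (h c.succ) (b c) else 0

theorem rowMatrix_boundary (w : Weights K) (M : ℕ) (lam mu : Finset ℕ) :
    rowMatrix w M (boundary M lam) (boundary M mu) = rowSum w lam mu (M + 1) Spin.plus := by
  rw [rowSum, ← sum_paths_eq_prod]; rfl

theorem Z_eq_prod_rowMatrix (W : ℕ → Weights K) (N M : ℕ) (lam mu : Finset ℕ) :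
    Z W N M lam mu =
      ((List.range N).map fun i => rowMatrix (W i) M).prod (boundary M lam) (boundary M mu) := by
  rw [← sum_paths_eq_prod, Z]
  refine Finset.sum_congr rfl fun v _ => ?_
  split_ifs with hv
  · simp only [hv.1, hv.2, true_and, rowMatrix, Matrix.of_apply, Finset.prod_univ_sum,
      Fintype.piFinset_univ]
    refine Finset.sum_congr rfl fun h _ => ?_
    rw [Finset.prod_ite_zero]
    simp only [Finset.mem_univ, true_imp_iff]
  · exact Finset.sum_eq_zero fun h _ => if_neg fun hh => hv ⟨hh.1, hh.2.1⟩

theorem boundary_bijOn (M : ℕ) : Set.BijOn (boundary M)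
    ((Finset.range (M + 1)).powerset : Set (Finset ℕ)) Set.univ := by
  refine ⟨fun _ _ => trivial, fun S hS T hT h => ?_, fun v _ => ?_⟩
  · ext c
    by_cases hc : c ∈ Finset.range (M + 1)
    · have := congrFun h ⟨c, Finset.mem_range.1 hc⟩
      by_cases hcS : c ∈ S <;> by_cases hcT : c ∈ T <;> simp_all [boundary]
    · exact iff_of_false (fun h => hc (Finset.mem_powerset.1 hS h))
        fun h => hc (Finset.mem_powerset.1 hT h)
  · refine ⟨(Finset.univ.filter (v · = Spin.minus)).map Fin.valEmbedding, ?_, funext fun c => ?_⟩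
    · rw [Finset.mem_coe, Finset.mem_powerset]
      intro c hc
      obtain ⟨d, -, rfl⟩ := Finset.mem_map.1 hc
      exact Finset.mem_range.2 d.2
    · cases h : v c <;> simp [boundary, h, Fin.val_inj]

theorem Z_zero (W : ℕ → Weights K) {M : ℕ} {lam mu : Finset ℕ}
    (hlam : lam ⊆ Finset.range (M + 1)) (hmu : mu ⊆ Finset.range (M + 1)) :
    Z W 0 M lam mu = if lam = mu then 1 else 0 := by
  rw [Z_eq_prod_rowMatrix, List.range_zero, List.map_nil, List.prod_nil, Matrix.one_apply]
  simp only [(boundary_bijOn M).injOn.eq_iff (Finset.mem_coe.2 (Finset.mem_powerset.2 hlam))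
    (Finset.mem_coe.2 (Finset.mem_powerset.2 hmu))]

theorem Z_succ (W : ℕ → Weights K) (N M : ℕ) (lam mu : Finset ℕ) :
    Z W (N + 1) M lam mu = ∑ kap ∈ (Finset.range (M + 1)).powerset,
      Z W N M lam kap * rowSum (W N) kap mu (M + 1) Spin.plus := by
  rw [Z_eq_prod_rowMatrix, List.prod_range_succ, Matrix.mul_apply]
  refine (Finset.sum_nbij (boundary M) (fun _ _ => Finset.mem_univ _) (boundary_bijOn M).injOn
    (by simpa only [Finset.coe_univ] using (boundary_bijOn M).surjOn) fun S _ => ?_).symm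
  rw [Z_eq_prod_rowMatrix, rowMatrix_boundary]

theorem sum_spin {M : Type*} [AddCommMonoid M] (f : Spin → M) :
    ∑ s, f s = f Spin.plus + f Spin.minus :=
  Finset.sum_pair (by decide)

theorem rowSum_succ (w : Weights K) (lam mu : Finset ℕ) (n : ℕ) (s : Spin) :
    rowSum w lam mu (n + 1) s =
      rowSum w lam mu n Spin.plus * w.vertex Spin.plus (spin mu n) s (spin lam n) +
        rowSum w lam mu n Spin.minus * w.vertex Spin.minus (spin mu n) s (spin lam n) := by
  rw [rowSum, List.prod_range_succ, Matrix.mul_apply, sum_spin]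
  rfl

theorem spin_insert_of_ne {S : Finset ℕ} {n c : ℕ} (hc : c ≠ n) :
    spin (insert n S) c = spin S c := by
  simp only [spin, Finset.mem_insert, hc, false_or]

theorem rowSum_insert_bottom (w : Weights K) (lam mu : Finset ℕ) (n : ℕ) :
    rowSum w (insert n lam) mu n = rowSum w lam mu n := by
  refine congrArg (fun L : List (Matrix Spin Spin K) => L.prod Spin.plus)
    (List.map_congr_left fun c hc => ?_)
  simp only [spin_insert_of_ne (List.mem_range.1 hc).ne]

theorem rowSum_insert_top (w : Weights K) (lam mu : Finset ℕ) (n : ℕ) :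
    rowSum w lam (insert n mu) n = rowSum w lam mu n := by
  refine congrArg (fun L : List (Matrix Spin Spin K) => L.prod Spin.plus)
    (List.map_congr_left fun c hc => ?_)
  simp only [spin_insert_of_ne (List.mem_range.1 hc).ne]

/-- The row with bottom spins `lam`, truncated after `n` columns with the spin `s` on the right, as
a linear combination of the possible top spins. -/
def rowVec (w : Weights K) (lam : Finset ℕ) (n : ℕ) (s : Spin) : FinWedge K :=
  ∑ mu ∈ (Finset.range n).powerset, rowSum w lam mu n s • wedge K mu

theorem rowVec_zero (w : Weights K) (lam : Finset ℕ) (s : Spin) :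
    rowVec w lam 0 s = if Spin.plus = s then wedge K ∅ else 0 := by
  simp [rowVec, rowSum, Matrix.one_apply]

theorem rowVec_insert (w : Weights K) (lam : Finset ℕ) (n : ℕ) (s : Spin) :
    rowVec w (insert n lam) n s = rowVec w lam n s := by
  simp only [rowVec, rowSum_insert_bottom]

theorem rowVec_succ (w : Weights K) (lam : Finset ℕ) (n : ℕ) (s : Spin) :
    rowVec w lam (n + 1) s = ∑ r, (w.vertex r Spin.plus s (spin lam n) • rowVec w lam n r +
      w.vertex r Spin.minus s (spin lam n) • create K n (rowVec w lam n r)) := by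
  have hplus (mu) (hmu : mu ∈ (Finset.range n).powerset) : spin mu n = Spin.plus :=
    if_neg fun h => Finset.notMem_range_self (Finset.mem_powerset.1 hmu h)
  have hminus (mu : Finset ℕ) : spin (insert n mu) n = Spin.minus :=
    if_pos (Finset.mem_insert_self n mu)
  simp only [rowVec, map_sum, map_smul, Finset.smul_sum, ← Finset.sum_add_distrib]
  rw [Finset.range_add_one, Finset.sum_powerset_insert Finset.notMem_range_self,
    ← Finset.sum_add_distrib, Finset.sum_comm]
  refine Finset.sum_congr rfl fun mu hmu => ?_
  rw [create_wedge_of_subset_range (Finset.mem_powerset.1 hmu), rowSum_succ, rowSum_succ,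
    rowSum_insert_top, hplus mu hmu, hminus, sum_spin]
  module

theorem rowVec_succ_plus (w : Weights K) {lam : Finset ℕ} {n : ℕ} (hlam : lam ⊆ Finset.range n) :
    rowVec w lam (n + 1) Spin.plus = w.a₁ • rowVec w lam n Spin.plus := by
  rw [rowVec_succ, spin, if_neg fun h => Finset.notMem_range_self (hlam h), sum_spin]
  simp [Weights.vertex]

theorem rowVec_succ_minus (w : Weights K) {lam : Finset ℕ} {n : ℕ} (hlam : lam ⊆ Finset.range n) :
    rowVec w lam (n + 1) Spin.minus =
      w.c₂ • create K n (rowVec w lam n Spin.plus) + w.b₂ • rowVec w lam n Spin.minus := by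
  rw [rowVec_succ, spin, if_neg fun h => Finset.notMem_range_self (hlam h), sum_spin]
  simp [Weights.vertex]

theorem rowVec_insert_succ_plus (w : Weights K) (lam : Finset ℕ) (n : ℕ) :
    rowVec w (insert n lam) (n + 1) Spin.plus =
      w.b₁ • create K n (rowVec w lam n Spin.plus) + w.c₁ • rowVec w lam n Spin.minus := by
  rw [rowVec_succ, spin, if_pos (Finset.mem_insert_self n lam), sum_spin]
  simp [Weights.vertex, rowVec_insert]

theorem rowVec_insert_succ_minus (w : Weights K) (lam : Finset ℕ) (n : ℕ) :
    rowVec w (insert n lam) (n + 1) Spin.minus =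
      w.a₂ • create K n (rowVec w lam n Spin.minus) := by
  rw [rowVec_succ, spin, if_pos (Finset.mem_insert_self n lam), sum_spin]
  simp [Weights.vertex, rowVec_insert]

/-- The row transfer operator of the first `n` columns. -/
def transferOp (w : Weights K) (n : ℕ) : Module.End K (FinWedge K) :=
  (wedge K).constr K fun lam => rowVec w lam n Spin.plus

theorem transferOp_wedge (w : Weights K) (n : ℕ) (lam : Finset ℕ) :
    transferOp w n (wedge K lam) = rowVec w lam n Spin.plus :=
  (wedge K).constr_basis K _ lam

/-- The product of the transfer operators of the first `N` rows, on `n` columns. -/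
def transferProd (W : ℕ → Weights K) (n : ℕ) : ℕ → Module.End K (FinWedge K)
  | 0 => 1
  | N + 1 => transferOp (W N) n * transferProd W n N

theorem transferProd_wedge (W : ℕ → Weights K) (N M : ℕ) {lam : Finset ℕ}
    (hlam : lam ⊆ Finset.range (M + 1)) : transferProd W (M + 1) N (wedge K lam) =
      ∑ mu ∈ (Finset.range (M + 1)).powerset, Z W N M lam mu • wedge K mu := by
  induction N with
  | zero =>
    rw [Finset.sum_congr rfl fun mu hmu => by rw [Z_zero W hlam (Finset.mem_powerset.1 hmu)]]
    simp [transferProd, hlam]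
  | succ N ih =>
    rw [transferProd, Module.End.mul_apply, ih]
    simp only [map_sum, map_smul, transferOp_wedge, rowVec, Finset.smul_sum, smul_smul]
    rw [Finset.sum_comm]
    simp only [← Finset.sum_smul, Z_succ]

end Transfer

/-! ### The transfer operator is an exponential -/

section RowOperator

variable {K : Type*} [Field K]

theorem subset_range_induction {P : ℕ → Finset ℕ → Prop} (zero : P 0 ∅)
    (succ : ∀ n, ∀ S ⊆ Finset.range n, P n S → P (n + 1) S)
    (insert : ∀ n, ∀ S ⊆ Finset.range n, P n S → P (n + 1) (insert n S)) :
    ∀ n, ∀ S ⊆ Finset.range n, P n S := by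
  intro n
  induction n with
  | zero => rintro S hS; rwa [Finset.subset_empty.1 hS]
  | succ n ih =>
    intro S hS
    rw [Finset.range_add_one, Finset.subset_insert_iff] at hS
    by_cases hn : n ∈ S
    · rw [← Finset.insert_erase hn]
      exact insert n _ hS (ih _ hS)
    · rw [Finset.erase_eq_of_notMem hn] at hS
      exact succ n S hS (ih S hS)

/-- Two weights of one row which differ by a rescaling of `c₁` and `c₂`. Along a row, vertices of
types `c₁` and `c₂` alternate, so that only the product `c₁ * c₂` matters. -/
structure GaugeEquiv (w w' : Weights K) : Prop where
  a₁ : w.a₁ = w'.a₁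
  a₂ : w.a₂ = w'.a₂
  b₁ : w.b₁ = w'.b₁
  b₂ : w.b₂ = w'.b₂
  c₁_mul_c₂ : w.c₁ * w.c₂ = w'.c₁ * w'.c₂

theorem GaugeEquiv.rowVec_eq {w w' : Weights K} (h : GaugeEquiv w w') :
    ∀ n, ∀ lam ⊆ Finset.range n, rowVec w lam n Spin.plus = rowVec w' lam n Spin.plus ∧
      w.c₁ • rowVec w lam n Spin.minus = w'.c₁ • rowVec w' lam n Spin.minus := by
  refine subset_range_induction (by simp [rowVec_zero]) (fun n S hS ih => ?_) fun n S _ ih => ?_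
  · simp only [rowVec_succ_plus _ hS, rowVec_succ_minus _ hS, smul_add, smul_smul, ih.1, h.a₁, h.b₂,
      h.c₁_mul_c₂, mul_comm _ w'.b₂, true_and]
    simp only [mul_smul, ih.2]
  · simp only [rowVec_insert_succ_plus, rowVec_insert_succ_minus, smul_smul, ih.1, ih.2, h.a₂, h.b₁,
      mul_comm _ w'.a₂, true_and]
    simp only [mul_smul, ← map_smul, ih.2]

theorem GaugeEquiv.transferProd_wedge_eq {W W' : ℕ → Weights K} (h : ∀ i, GaugeEquiv (W i) (W' i))
    (N M : ℕ) {lam : Finset ℕ} (hlam : lam ⊆ Finset.range (M + 1)) :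
    transferProd W (M + 1) N (wedge K lam) = transferProd W' (M + 1) N (wedge K lam) := by
  induction N with
  | zero => rfl
  | succ N ih =>
    rw [transferProd, transferProd, Module.End.mul_apply, Module.End.mul_apply, ih,
      transferProd_wedge W' N M hlam, map_sum, map_sum]
    refine Finset.sum_congr rfl fun mu hmu => ?_
    rw [map_smul, map_smul, transferOp_wedge, transferOp_wedge,
      ((h N).rowVec_eq _ mu (Finset.mem_powerset.1 hmu)).1]

/-- The weights `𝔖(x, y, A, B)` of one row for `A = B = 1`. -/
def unitWeights (x y : K) : Weights K where
  a₁ := 1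
  a₂ := y
  b₁ := 1
  b₂ := x
  c₁ := x + y
  c₂ := 1

theorem rowVec_weights (x y A B : ℕ → K) (i : ℕ) :
    ∀ n, ∀ lam ⊆ Finset.range n, ∀ s, rowVec (weights x y A B i) lam n s =
      (A i ^ n * B i ^ lam.card) • rowVec (unitWeights (x i) (y i)) lam n s := by
  refine subset_range_induction (by simp [rowVec_zero]) (fun n S hS ih => ?_) fun n S hS ih => ?_
  · rintro (_ | _)
    · rw [rowVec_succ_plus _ hS, rowVec_succ_plus _ hS, ih, weights, unitWeights]
      module
    · rw [rowVec_succ_minus _ hS, rowVec_succ_minus _ hS, ih, ih, map_smul, weights, unitWeights]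
      module
  · have hn : n ∉ S := fun h => Finset.notMem_range_self (hS h)
    rw [Finset.card_insert_of_notMem hn]
    rintro (_ | _)
    · rw [rowVec_insert_succ_plus, rowVec_insert_succ_plus, ih, ih, map_smul, weights, unitWeights]
      module
    · rw [rowVec_insert_succ_minus, rowVec_insert_succ_minus, ih, map_smul, weights, unitWeights]
      module

variable (x y : K)

/-- The transfer operator of a row of unlimited width with weights `unitWeights x y`. -/
def rowOp : Module.End K (FinWedge K) :=
  (wedge K).constr K fun lam => transferOp (unitWeights x y) (lam.sup (· + 1)) (wedge K lam)

variable {x y}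

theorem transferOp_unitWeights_wedge {lam : Finset ℕ} {m n : ℕ} (hlam : lam ⊆ Finset.range m)
    (hmn : m ≤ n) : transferOp (unitWeights x y) n (wedge K lam) =
      transferOp (unitWeights x y) m (wedge K lam) := by
  induction n, hmn using Nat.le_induction with
  | base => rfl
  | succ n hmn ih =>
    rw [← ih, transferOp_wedge, transferOp_wedge,
      rowVec_succ_plus _ (hlam.trans (Finset.range_subset_range.2 hmn)), unitWeights, one_smul]

theorem rowOp_eq_transferOp {n : ℕ} {v : FinWedge K} (hv : v ∈ wedgesBelow K n) :
    rowOp x y v = transferOp (unitWeights x y) n v := by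
  refine LinearMap.eqOn_span (f := rowOp x y) (Set.forall_mem_image.2 fun lam hlam => ?_) hv
  rw [rowOp, Module.Basis.constr_basis, transferOp_unitWeights_wedge (fun p hp => ?_)
    (Finset.sup_le fun p hp => Finset.mem_range.1 (hlam hp))]
  exact Finset.mem_range.2 (Finset.le_sup (f := (· + 1)) hp)

theorem smul_rowVec_unitWeights_minus (n : ℕ) (S : Finset ℕ) (hS : S ⊆ Finset.range n) :
    (unitWeights x y).c₁ • rowVec (unitWeights x y) S n Spin.minus =
      y • wedgeMul K (shiftAct K PowerSeries.X (mode K n))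
          (rowVec (unitWeights x y) S n Spin.plus) +
        x • transferOp (unitWeights x y) n
          (wedgeMul K (shiftAct K PowerSeries.X (mode K n)) (wedge K S)) := by
  revert n S
  have create_create (n : ℕ) (v : FinWedge K) : create K n (create K n v) = 0 :=
    LinearMap.congr_fun (create_mul_self n) v
  refine subset_range_induction (by simp [rowVec_zero, shiftAct_X_mode_zero])
    (fun n S hS _ => ?_) fun n S _ _ => ?_
  · rw [shiftAct_X_mode_succ, wedgeMul_mode, create_wedge_of_subset_range hS, transferOp_wedge,
      rowVec_succ_minus _ hS, rowVec_succ_plus _ hS, rowVec_insert_succ_plus, map_smul,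
      unitWeights]
    module
  · rw [shiftAct_X_mode_succ, wedgeMul_mode, create_wedge, if_pos (Finset.mem_insert_self n S),
      rowVec_insert_succ_minus, rowVec_insert_succ_plus, map_add, map_smul, map_smul,
      create_create, map_zero, unitWeights]
    module

theorem intertwines_rowOp (x y : K) :
    Intertwines (shiftAct K (1 - PowerSeries.C x * PowerSeries.X))
      (shiftAct K (1 + PowerSeries.C y * PowerSeries.X)) (rowOp x y) := by
  have hshift (p : ℕ) :
      shiftAct K PowerSeries.X (mode K p) ∈ Finsupp.supported K K (Set.Iio p) := by
    rcases p with _ | p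
    · rw [shiftAct_X_mode_zero]
      exact Submodule.zero_mem _
    · rw [shiftAct_X_mode_succ]
      exact Finsupp.single_mem_supported K 1 p.lt_succ_self
  have hact (c : K) (p : ℕ) : shiftAct K (PowerSeries.C c * PowerSeries.X) (mode K p) =
      c • shiftAct K PowerSeries.X (mode K p) := by
    rw [← PowerSeries.smul_eq_C_mul, map_smul, LinearMap.smul_apply]
  refine Intertwines.of_subset_range (fun p => ?_) ?_ fun p S hS => ?_
  · rw [map_sub, map_one, LinearMap.sub_apply, hact, Module.End.one_apply, sub_sub_cancel_left]
    exact Submodule.neg_mem _ (Submodule.smul_mem _ x (hshift p))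
  · rw [rowOp_eq_transferOp (wedge_mem_wedgesBelow (n := 0) (Finset.empty_subset _)),
      transferOp_wedge, rowVec_zero, if_pos rfl]
  · have hS' : insert p S ⊆ Finset.range (p + 1) := by
      rw [Finset.range_add_one]
      exact Finset.insert_subset_insert p hS
    have hwedge := wedge_mem_wedgesBelow (K := K) hS
    have hminus := smul_rowVec_unitWeights_minus (x := x) (y := y) p S hS
    have hplus := rowVec_insert_succ_plus (unitWeights x y) S p
    rw [map_sub, map_add, map_one, LinearMap.sub_apply, LinearMap.add_apply, hact, hact,
      Module.End.one_apply, map_sub, map_add, map_smul, map_smul, LinearMap.sub_apply,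
      LinearMap.add_apply, LinearMap.smul_apply, LinearMap.smul_apply, map_sub, map_smul,
      wedgeMul_mode, create_wedge_of_subset_range hS,
      rowOp_eq_transferOp (wedge_mem_wedgesBelow hS'), rowOp_eq_transferOp hwedge,
      rowOp_eq_transferOp (wedgeMul_mem_wedgesBelow (hshift p) hwedge), transferOp_wedge,
      transferOp_wedge, hplus, hminus, unitWeights]
    module

variable [CharZero K]

theorem transferOp_weights_wedge (x y A B : ℕ → K) (i : ℕ) {n : ℕ} {lam : Finset ℕ}
    (hlam : lam ⊆ Finset.range n) : transferOp (weights x y A B i) n (wedge K lam) =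
      (A i ^ n * B i ^ lam.card) • expOp (superPowerSum (x i) (y i)) (wedge K lam) := by
  rw [transferOp_wedge, rowVec_weights x y A B i n lam hlam, ← transferOp_wedge,
    ← rowOp_eq_transferOp (wedge_mem_wedgesBelow hlam),
    (intertwines_rowOp _ _).eq_expOp_superPowerSum]

end RowOperator

/-! ### Charge sectors -/

section Sector

variable {K : Type*} [Field K]

/-- The span of the wedges of `l` of the vectors `v_0, …, v_{n-1}`. -/
def sector (K : Type*) [Field K] (n l : ℕ) : Submodule K (FinWedge K) :=
  Submodule.span K (wedge K '' {S | S ⊆ Finset.range n ∧ S.card = l})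

theorem wedge_mem_sector {n : ℕ} {S : Finset ℕ} (hS : S ⊆ Finset.range n) :
    wedge K S ∈ sector K n S.card :=
  Submodule.subset_span ⟨S, ⟨hS, rfl⟩, rfl⟩

theorem create_mem_sector {n l q : ℕ} (hq : q < n) {v : FinWedge K} (hv : v ∈ sector K n l) :
    create K q v ∈ sector K n (l + 1) := by
  refine (Submodule.span_le (p := (sector K n (l + 1)).comap (create K q))).2 ?_ hv
  rintro _ ⟨S, ⟨hS, rfl⟩, rfl⟩
  rw [SetLike.mem_coe, Submodule.mem_comap, create_wedge]
  split_ifs with hqS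
  · exact Submodule.zero_mem _
  · rw [← Finset.card_insert_of_notMem hqS]
    exact Submodule.smul_mem _ _
      (wedge_mem_sector (Finset.insert_subset (Finset.mem_range.2 hq) hS))

theorem secondQuantize_shiftAct_mem_sector (f : PowerSeries K) {n l : ℕ} {v : FinWedge K}
    (hv : v ∈ sector K n l) : secondQuantize (shiftAct K f) v ∈ sector K n l := by
  refine (Submodule.span_le (p := (sector K n l).comap (secondQuantize (shiftAct K f)))).2 ?_ hv
  rintro _ ⟨S, ⟨hS, rfl⟩, rfl⟩
  rw [SetLike.mem_coe, Submodule.mem_comap, secondQuantize_wedge]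
  refine Submodule.sum_mem _ fun p hp => ?_
  have herase := wedge_mem_sector (K := K) ((S.erase_subset p).trans hS)
  rw [annihilate_wedge, if_pos hp, map_smul, shiftAct_mode, map_sum, LinearMap.sum_apply]
  refine Submodule.smul_mem _ _ (Submodule.sum_mem _ fun kl hkl => ?_)
  rw [map_smul, LinearMap.smul_apply, wedgeMul_mode, ← Finset.card_erase_add_one hp]
  exact Submodule.smul_mem _ _ (create_mem_sector
    ((Finset.HasAntidiagonal.antidiagonal.snd_le hkl).trans_lt (Finset.mem_range.1 (hS hp))) herase)

theorem expOp_mem_sector (t : ℕ+ → K) {n l : ℕ} {v : FinWedge K} (hv : v ∈ sector K n l) :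
    expOp t v ∈ sector K n l :=
  expEnd_mem _ (fun _ => secondQuantize_shiftAct_mem_sector _) hv

end Sector

/-! ### Adjoints in Fock space -/

namespace Maya

theorem erase_insert {S : Maya} {p : ℤ} (hp : p ∉ S.occ) : (S.insert p).erase p = S := by
  ext q
  simp only [insert, erase, Set.mem_sdiff, Set.mem_insert_iff, Set.mem_singleton_iff]
  grind

theorem insert_erase {S : Maya} {p : ℤ} (hp : p ∈ S.occ) : (S.erase p).insert p = S := by
  ext q
  simp only [insert, erase, Set.mem_sdiff, Set.mem_insert_iff, Set.mem_singleton_iff]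
  grind

theorem sign_erase_self (K : Type*) [Field K] (S : Maya) (p : ℤ) :
    (S.erase p).sign K p = S.sign K p := by
  have : {q | q ∈ (S.erase p).occ ∧ p < q} = {q | q ∈ S.occ ∧ p < q} := by
    ext q
    simp only [erase, Set.mem_sdiff, Set.mem_singleton_iff, Set.mem_ofPred_eq]
    grind
  rw [sign, sign, this]

end Maya

section Adjoint

variable {K : Type*} [Field K]

open Classical in
theorem psiStar_single (p : ℤ) (S : Maya) : psiStar K p (Finsupp.single S 1) =
    if p ∈ S.occ then 0 else S.sign K p • Finsupp.single (S.insert p) 1 := by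
  simp [psiStar]

open Classical in
theorem psi_single (p : ℤ) (S : Maya) : psi K p (Finsupp.single S 1) =
    if p ∈ S.occ then S.sign K p • Finsupp.single (S.erase p) 1 else 0 := by
  simp [psi]

/-- The symmetric bilinear form on Fock space for which the particle configurations are
orthonormal. -/
def pairing (K : Type*) [Field K] : Fock K →ₗ[K] Fock K →ₗ[K] K :=
  Finsupp.linearCombination K Finsupp.lapply

theorem pairing_single (S : Maya) (v : Fock K) : pairing K (Finsupp.single S 1) v = v S := by
  rw [pairing, Finsupp.linearCombination_single, one_smul, Finsupp.lapply_apply]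

theorem pairing_comm (u v : Fock K) : pairing K u v = pairing K v u := by
  have hflip : pairing K = (pairing K).flip := by
    refine Finsupp.basisSingleOne.ext fun S => Finsupp.basisSingleOne.ext fun T => ?_
    classical
    simp only [LinearMap.flip_apply, Finsupp.coe_basisSingleOne, pairing_single,
      Finsupp.single_apply, eq_comm]
  exact LinearMap.congr_fun₂ hflip u v

theorem isAdjointPair_of_single {X Y : Module.End K (Fock K)}
    (h : ∀ S T, X (Finsupp.single S 1) T = Y (Finsupp.single T 1) S) :
    LinearMap.IsAdjointPair (pairing K) (pairing K) X Y := by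
  refine LinearMap.isAdjointPair_iff_comp_eq_compl₂.2 <|
    Finsupp.basisSingleOne.ext fun S => Finsupp.basisSingleOne.ext fun T => ?_
  rw [LinearMap.comp_apply, LinearMap.compl₂_apply, Finsupp.coe_basisSingleOne, pairing_comm,
    pairing_single, pairing_single, h]

theorem isAdjointPair_symm {X Y : Module.End K (Fock K)}
    (h : LinearMap.IsAdjointPair (pairing K) (pairing K) X Y) :
    LinearMap.IsAdjointPair (pairing K) (pairing K) Y X := fun u v => by
  rw [pairing_comm, ← h, pairing_comm]

theorem isAdjointPair_list_prod {ι : Type*} {X Y : ι → Module.End K (Fock K)} {l : List ι}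
    (h : ∀ i ∈ l, LinearMap.IsAdjointPair (pairing K) (pairing K) (X i) (Y i)) :
    LinearMap.IsAdjointPair (pairing K) (pairing K) (l.map X).prod (l.reverse.map Y).prod := by
  induction l with
  | nil => exact LinearMap.isAdjointPair_one
  | cons i l ih =>
    rw [List.map_cons, List.prod_cons, List.reverse_cons, List.map_append, List.prod_append,
      List.map_singleton, List.prod_singleton]
    exact (h i List.mem_cons_self).mul (ih fun j hj => h j (List.mem_cons_of_mem i hj))

theorem isAdjointPair_psi_psiStar (p : ℤ) :
    LinearMap.IsAdjointPair (pairing K) (pairing K) (psi K p) (psiStar K p) := by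
  refine isAdjointPair_of_single fun S T => ?_
  have hiff : p ∈ S.occ ∧ S.erase p = T ↔ p ∉ T.occ ∧ T.insert p = S := by
    constructor
    · rintro ⟨hp, rfl⟩
      exact ⟨fun h => h.2 rfl, Maya.insert_erase hp⟩
    · rintro ⟨hp, rfl⟩
      exact ⟨Or.inl rfl, Maya.erase_insert hp⟩
  by_cases h : p ∈ S.occ ∧ S.erase p = T
  · obtain ⟨hT, hTS⟩ := hiff.1 h
    obtain ⟨hS, rfl⟩ := h
    rw [psi_single, psiStar_single, if_pos hS, if_neg hT, hTS, Maya.sign_erase_self]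
    simp
  · have := mt hiff.2 h
    simp only [psi_single, psiStar_single]
    split_ifs <;> simp_all

theorem isAdjointPair_psiStar_psi (p : ℤ) :
    LinearMap.IsAdjointPair (pairing K) (pairing K) (psiStar K p) (psi K p) :=
  isAdjointPair_symm (isAdjointPair_psi_psiStar p)

theorem reverse_sort_ge (lam : Finset ℕ) : (lam.sort (· ≥ ·)).reverse = lam.sort (· ≤ ·) :=
  List.Perm.eq_of_sortedLE (lam.sortedGT_sort.reverse.sortedLE) lam.sortedLT_sort.sortedLE
    ((List.reverse_perm _).trans ((lam.sort_perm_toList _).trans (lam.sort_perm_toList _).symm))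

theorem bra_apply (lam : StrictPartition) (v : Fock K) : bra K lam v = pairing K (ket K lam) v := by
  have hadj := isAdjointPair_list_prod (l := lam.sort (· ≥ ·)) fun p _ =>
    isAdjointPair_psiStar_psi (K := K) (p : ℤ)
  rw [ket, hadj, reverse_sort_ge, vac, pairing_single, bra]

theorem normalOrdered_of_ne {i j : ℤ} (hij : j ≠ i) :
    normalOrdered K j i = psiStar K j * psi K i := by
  have hvac : vacuumExpectation K (psiStar K j * psi K i) = 0 := by
    rw [vacuumExpectation, Module.End.mul_apply, ← pairing_single, ← isAdjointPair_psi_psiStar,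
      vac, psi_single, psi_single]
    split_ifs with hj hi
    · have : Maya.vacuum.erase i ≠ Maya.vacuum.erase j := fun h => by
        have hi' : i ∈ (Maya.vacuum.erase j).occ := ⟨hi, hij.symm⟩
        exact (h ▸ hi').2 rfl
      rw [map_smul, map_smul, LinearMap.smul_apply, pairing_single, Finsupp.single_eq_of_ne,
        smul_zero, smul_zero]
      exact this.symm
    all_goals simp
  rw [normalOrdered, hvac, zero_smul]
  exact sub_zero (psiStar K j * psi K i)

theorem current_single {n : ℤ} (hn : n ≠ 0) (S : Maya) : current K n (Finsupp.single S 1) =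
    ∑ᶠ i : ℤ, psiStar K (i - n) (psi K i (Finsupp.single S 1)) := by
  rw [current, Finsupp.linearCombination_single, one_smul]
  refine finsum_congr fun i => ?_
  rw [normalOrdered_of_ne (by omega), Module.End.mul_apply]

theorem mem_of_psiStar_psi_ne_zero {i j : ℤ} {S : Maya} (hij : j ≠ i)
    (h : psiStar K j (psi K i (Finsupp.single S 1)) ≠ 0) : i ∈ S.occ ∧ j ∉ S.occ := by
  rw [psi_single] at h
  by_cases hi : i ∈ S.occ
  · refine ⟨hi, fun hj => h ?_⟩
    rw [if_pos hi, map_smul, psiStar_single, if_pos ⟨hj, hij⟩, smul_zero]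
  · rw [if_neg hi, map_zero] at h
    exact absurd rfl h

theorem hasFiniteSupport_psiStar_psi {n : ℤ} (hn : n ≠ 0) (S : Maya) :
    Function.HasFiniteSupport fun i : ℤ => psiStar K (i - n) (psi K i (Finsupp.single S 1)) := by
  have hshift : ((fun i : ℤ => i - n) ⁻¹' symmDiff S.occ (Set.Iio 0)).Finite :=
    S.finite_symmDiff.preimage sub_left_injective.injOn
  refine ((S.finite_symmDiff.union hshift).union (Set.finite_Icc (-|n|) |n|)).subset fun i hi => ?_
  obtain ⟨hmem, hnot⟩ := mem_of_psiStar_psi_ne_zero (by omega) hi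
  simp only [Set.mem_union, Set.mem_symmDiff, Set.mem_preimage, Set.mem_Iio, Set.mem_Icc, hmem,
    hnot, not_true, not_false_iff, true_and, and_true, false_and, and_false, or_false, false_or]
  grind

theorem isAdjointPair_current {n : ℤ} (hn : n ≠ 0) :
    LinearMap.IsAdjointPair (pairing K) (pairing K) (current K n) (current K (-n)) := by
  refine isAdjointPair_of_single fun S T => ?_
  rw [current_single hn, current_single (neg_ne_zero.2 hn), ← Finsupp.lapply_apply (R := K) T,
    ← Finsupp.lapply_apply (R := K) S, map_finsum _ (hasFiniteSupport_psiStar_psi hn S),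
    map_finsum _ (hasFiniteSupport_psiStar_psi (neg_ne_zero.2 hn) T),
    ← finsum_comp_equiv (Equiv.addRight n)]
  refine finsum_congr fun i => ?_
  rw [Finsupp.lapply_apply, Finsupp.lapply_apply, ← pairing_single, pairing_comm,
    isAdjointPair_psiStar_psi, isAdjointPair_psi_psiStar, pairing_single, Equiv.coe_addRight,
    add_sub_cancel_right, sub_neg_eq_add]

end Adjoint

/-! ### Finite wedges in Fock space -/

section Sea

variable {K : Type*} [Field K]

/-- The configuration in which the negative positions and the positions in `S` are occupied; it
stands for `S ∧ v_{-1} ∧ v_{-2} ∧ ⋯`. -/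
def sea (S : Finset ℕ) : Maya where
  occ := Set.Iio 0 ∪ Nat.cast '' (S : Set ℕ)
  finite_symmDiff := by
    refine (S.finite_toSet.image (Nat.cast : ℕ → ℤ)).subset fun q hq => ?_
    simp only [Set.mem_symmDiff, Set.mem_union] at hq
    tauto

theorem mem_sea {S : Finset ℕ} {q : ℤ} : q ∈ (sea S).occ ↔ q < 0 ∨ ∃ c ∈ S, (c : ℤ) = q := by
  simp [sea]

theorem natCast_mem_sea {S : Finset ℕ} {p : ℕ} : (p : ℤ) ∈ (sea S).occ ↔ p ∈ S := by
  simp [mem_sea]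

theorem sea_empty : sea ∅ = Maya.vacuum := by
  ext q
  simp [mem_sea, Maya.vacuum]

theorem sea_insert (S : Finset ℕ) (p : ℕ) : (sea S).insert p = sea (insert p S) := by
  ext q
  simp only [Maya.insert, Set.mem_insert_iff, mem_sea, Finset.mem_insert, exists_eq_or_imp]
  grind

theorem sea_erase (S : Finset ℕ) (p : ℕ) : (sea S).erase p = sea (S.erase p) := by
  ext q
  simp only [Maya.erase, Set.mem_sdiff, Set.mem_singleton_iff, mem_sea, Finset.mem_erase]
  grind

theorem sea_injective : Function.Injective sea := fun S T h => by
  ext p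
  rw [← natCast_mem_sea, h, natCast_mem_sea]

theorem sign_sea (S : Finset ℕ) (p : ℕ) : (sea S).sign K p = wedgeSign K S p := by
  have habove : {q : ℤ | q ∈ (sea S).occ ∧ (p : ℤ) < q} =
      ((S.filter (p < ·)).map Nat.castEmbedding : Finset ℤ) := by
    ext q
    simp only [mem_sea, Set.mem_ofPred_eq, Finset.coe_map, Set.mem_image, Finset.mem_coe,
      Finset.mem_filter, Nat.castEmbedding_apply]
    grind
  rw [Maya.sign, habove, Set.ncard_coe_finset, Finset.card_map, wedgeSign]

/-- The embedding of finite wedges into Fock space. -/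
def toFock : FinWedge K →ₗ[K] Fock K :=
  (wedge K).constr K fun S => Finsupp.single (sea S) 1

theorem toFock_wedge (S : Finset ℕ) : toFock (wedge K S) = Finsupp.single (sea S) 1 :=
  (wedge K).constr_basis K _ S

theorem toFock_apply_sea (v : FinWedge K) (S : Finset ℕ) :
    toFock v (sea S) = (wedge K).repr v S := by
  have hcoord : Finsupp.lapply (sea S) ∘ₗ toFock = (wedge K).coord S := by
    refine (wedge K).ext fun T => ?_
    rw [LinearMap.comp_apply, toFock_wedge, Finsupp.lapply_apply, Module.Basis.coord_apply,
      Module.Basis.repr_self, Finsupp.single_apply_left sea_injective]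
  exact LinearMap.congr_fun hcoord v

theorem psiStar_toFock (p : ℕ) (v : FinWedge K) :
    psiStar K p (toFock v) = toFock (create K p v) := by
  have hcomp : psiStar K p ∘ₗ toFock = toFock ∘ₗ create K p := by
    refine (wedge K).ext fun S => ?_
    rw [LinearMap.comp_apply, LinearMap.comp_apply, toFock_wedge, psiStar_single, create_wedge,
      sea_insert, sign_sea]
    simp only [natCast_mem_sea, apply_ite toFock, map_zero, map_smul, toFock_wedge]
  exact LinearMap.congr_fun hcomp v

theorem psi_toFock (p : ℕ) (v : FinWedge K) :
    psi K p (toFock v) = toFock (annihilate K p v) := by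
  have hcomp : psi K p ∘ₗ toFock = toFock ∘ₗ annihilate K p := by
    refine (wedge K).ext fun S => ?_
    rw [LinearMap.comp_apply, LinearMap.comp_apply, toFock_wedge, psi_single, annihilate_wedge,
      sea_erase, sign_sea]
    simp only [natCast_mem_sea, apply_ite toFock, map_zero, map_smul, toFock_wedge]
  exact LinearMap.congr_fun hcomp v

theorem ket_eq_toFock (lam : StrictPartition) : ket K lam = toFock (wedge K lam) := by
  induction lam using Finset.induction_on_max with
  | empty => simp [ket, vac, sea_empty, toFock_wedge]
  | insert p S hS ih =>
    have hp : p ∉ S := fun h => (hS p h).false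
    rw [ket] at ih ⊢
    rw [Finset.sort_insert (· ≥ ·) (fun q hq => (hS q hq).le) hp, List.map_cons, List.prod_cons,
      Module.End.mul_apply, ih, psiStar_toFock,
      create_wedge_of_subset_range fun q hq => Finset.mem_range.2 (hS q hq)]

theorem bra_toFock (lam : StrictPartition) (v : FinWedge K) :
    bra K lam (toFock v) = (wedge K).repr v lam := by
  rw [bra_apply, ket_eq_toFock, toFock_wedge, pairing_single, toFock_apply_sea]

end Sea

section Current

variable {K : Type*} [Field K]

/-- The operator `J_k` on finite wedges, for `k ≥ 1`. -/
def wedgeCurrent (K : Type*) [Field K] (k : ℕ) : Module.End K (FinWedge K) :=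
  secondQuantize (shiftAct K (PowerSeries.X ^ k))

theorem wedgeCurrent_wedge (k : ℕ) (S : Finset ℕ) : wedgeCurrent K k (wedge K S) =
    ∑ p ∈ S with k ≤ p, create K (p - k) (annihilate K p (wedge K S)) := by
  rw [wedgeCurrent, secondQuantize_wedge, Finset.sum_filter]
  refine Finset.sum_congr rfl fun p _ => ?_
  rw [shiftAct_X_pow_mode]
  split_ifs
  · rw [wedgeMul_mode]
  · rw [map_zero, LinearMap.zero_apply]

theorem current_toFock {k : ℕ} (hk : 1 ≤ k) (v : FinWedge K) :
    current K k (toFock v) = toFock (wedgeCurrent K k v) := by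
  have hcomp : current K k ∘ₗ toFock = toFock ∘ₗ wedgeCurrent K k := by
    refine (wedge K).ext fun S => ?_
    rw [LinearMap.comp_apply, LinearMap.comp_apply, toFock_wedge, current_single (by omega),
      wedgeCurrent_wedge, finsum_eq_sum_of_support_subset (s :=
        (S.filter (k ≤ ·)).map Nat.castEmbedding), Finset.sum_map, map_sum]
    · refine Finset.sum_congr rfl fun p hp => ?_
      rw [Nat.castEmbedding_apply, ← toFock_wedge, psi_toFock,
        ← Nat.cast_sub (Finset.mem_filter.1 hp).2, psiStar_toFock]
    · intro i hi
      obtain ⟨hmem, hnot⟩ := mem_of_psiStar_psi_ne_zero (by omega) hi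
      rw [mem_sea] at hmem hnot
      simp only [Finset.coe_map, Set.mem_image, Finset.mem_coe, Finset.mem_filter,
        Nat.castEmbedding_apply]
      grind
  exact LinearMap.congr_fun hcomp v

theorem prod_current_toFock {m : ℕ} (k : Fin m → ℕ+) (v : FinWedge K) :
    (List.ofFn fun i => current K (k i : ℤ)).prod (toFock v) =
      toFock ((List.ofFn fun i => wedgeCurrent K (k i)).prod v) := by
  induction m with
  | zero => simp
  | succ m ih =>
    rw [List.ofFn_succ, List.ofFn_succ, List.prod_cons, List.prod_cons, Module.End.mul_apply,
      Module.End.mul_apply, ih]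
    exact current_toFock (k 0).2 _

theorem prod_wedgeCurrent_mem_sector {m n l : ℕ} (k : Fin m → ℕ) {v : FinWedge K}
    (hv : v ∈ sector K n l) : (List.ofFn fun i => wedgeCurrent K (k i)).prod v ∈ sector K n l :=
  List.prod_induction (fun X : Module.End K (FinWedge K) => ∀ v ∈ sector K n l, X v ∈ sector K n l)
    (fun _ _ hX hY v hv => hX _ (hY v hv)) (fun _ hv => hv)
    (List.forall_mem_ofFn_iff.2 fun _ _ => secondQuantize_shiftAct_mem_sector _) v hv

theorem eqOn_sector {X Y : Module.End K (FinWedge K)} {n l : ℕ}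
    (h : ∀ S ⊆ Finset.range n, S.card = l → X (wedge K S) = Y (wedge K S)) :
    Set.EqOn X Y (sector K n l) :=
  LinearMap.eqOn_span fun _ ⟨S, ⟨hS, hcard⟩, hv⟩ => hv ▸ h S hS hcard

theorem wedgeCurrent_eq_zero {k n l : ℕ} (hk : n ≤ k) {v : FinWedge K} (hv : v ∈ sector K n l) :
    wedgeCurrent K k v = 0 := by
  refine eqOn_sector (Y := 0) (fun S hS _ => ?_) hv
  rw [wedgeCurrent_wedge, Finset.filter_false_of_mem fun p hp => ?_, Finset.sum_empty,
    LinearMap.zero_apply]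
  exact ((Finset.mem_range.1 (hS hp)).trans_le hk).not_ge

theorem prod_wedgeCurrent_eq_zero {m n l : ℕ} (k : Fin m → ℕ) {i : Fin m} (hi : n ≤ k i)
    {v : FinWedge K} (hv : v ∈ sector K n l) :
    (List.ofFn fun i => wedgeCurrent K (k i)).prod v = 0 := by
  induction m with
  | zero => exact i.elim0
  | succ m ih =>
    rw [List.ofFn_succ, List.prod_cons, Module.End.mul_apply]
    cases i using Fin.cases with
    | zero => exact wedgeCurrent_eq_zero hi (prod_wedgeCurrent_mem_sector _ hv)
    | succ i => rw [ih (fun i => k i.succ) hi, map_zero]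

theorem shiftAct_currentSeries_mode (t : ℕ+ → K) {n p : ℕ} (hp : p < n) :
    shiftAct K (currentSeries t) (mode K p) =
      ∑ j : Fin n, t (j : ℕ).succPNat • shiftAct K (PowerSeries.X ^ ((j : ℕ) + 1)) (mode K p) := by
  ext i
  simp only [Finsupp.finsetSum_apply, Finsupp.smul_apply, shiftAct_mode_apply,
    PowerSeries.coeff_mul_X_pow', PowerSeries.coeff_X_pow, smul_eq_mul]
  rcases lt_or_ge p i with hpi | hip
  · simp [hpi.not_ge]
  · simp only [if_pos hip, mul_ite, mul_one, mul_zero]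
    rcases hk : p - i with _ | k
    · rw [PowerSeries.coeff_zero_eq_constantCoeff_apply, constantCoeff_currentSeries]
      simp
    · rw [coeff_succ_currentSeries, Finset.sum_eq_single (⟨k, by omega⟩ : Fin n)]
      · simp
      · intro j _ hj
        rw [if_neg]
        rwa [Nat.succ_inj, eq_comm, ← Fin.ext_iff (b := ⟨k, by omega⟩)]
      · simp

theorem hamiltonian_eq_sum_wedgeCurrent (t : ℕ+ → K) {n l : ℕ} {v : FinWedge K}
    (hv : v ∈ sector K n l) :
    hamiltonian t v = ∑ j : Fin n, t (j : ℕ).succPNat • wedgeCurrent K (j + 1) v := by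
  have hsum : ∀ S ⊆ Finset.range n, S.card = l → hamiltonian t (wedge K S) =
      (∑ j : Fin n, t (j : ℕ).succPNat • wedgeCurrent K (j + 1)) (wedge K S) := fun S hS _ => by
    simp only [LinearMap.sum_apply, LinearMap.smul_apply, hamiltonian, wedgeCurrent,
      secondQuantize_wedge, Finset.smul_sum]
    rw [Finset.sum_comm]
    refine Finset.sum_congr rfl fun p hp => ?_
    rw [shiftAct_currentSeries_mode t (Finset.mem_range.1 (hS hp))]
    simp only [map_sum, map_smul, LinearMap.sum_apply, LinearMap.smul_apply]
  simpa only [LinearMap.sum_apply, LinearMap.smul_apply] using eqOn_sector hsum hv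

theorem hamiltonian_pow_eq_sum (t : ℕ+ → K) (m : ℕ) {n l : ℕ} {v : FinWedge K}
    (hv : v ∈ sector K n l) :
    (hamiltonian t ^ m) v = ∑ k : Fin m → Fin n, (∏ i, t (k i : ℕ).succPNat) •
      (List.ofFn fun i => wedgeCurrent K (k i + 1)).prod v := by
  induction m with
  | zero => simp
  | succ m ih =>
    have hmem : (hamiltonian t ^ m) v ∈ sector K n l := by
      rw [ih]
      exact Submodule.sum_mem _ fun k _ =>
        Submodule.smul_mem _ _ (prod_wedgeCurrent_mem_sector _ hv)
    rw [pow_succ', Module.End.mul_apply, hamiltonian_eq_sum_wedgeCurrent t hmem, ih,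
      ← (Fin.consEquiv fun _ : Fin (m + 1) => Fin n).sum_comp, Fintype.sum_prod_type]
    refine Finset.sum_congr rfl fun j _ => ?_
    rw [map_sum, Finset.smul_sum]
    refine Finset.sum_congr rfl fun k _ => ?_
    simp [Fin.consEquiv, Fin.prod_univ_succ, List.ofFn_succ, smul_smul]

theorem finsum_prod_wedgeCurrent (t : ℕ+ → K) (m : ℕ) (α β : StrictPartition) :
    ∑ᶠ k : Fin m → ℕ+, (∏ i, t (k i)) *
      (wedge K).repr ((List.ofFn fun i => wedgeCurrent K (k i)).prod (wedge K β)) α =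
      (wedge K).repr ((hamiltonian t ^ m) (wedge K β)) α := by
  obtain ⟨n, hn⟩ := β.exists_nat_subset_range
  have hβ := wedge_mem_sector (K := K) hn
  let e : (Fin m → Fin n) ↪ (Fin m → ℕ+) :=
    ⟨fun k i => (k i : ℕ).succPNat, fun k l h =>
      funext fun i => Fin.val_injective (Nat.succPNat_injective (congrFun h i))⟩
  rw [finsum_eq_sum_of_support_subset (s := Finset.univ.map e), Finset.sum_map,
    hamiltonian_pow_eq_sum t m hβ, map_sum, Finsupp.finsetSum_apply]
  · simp only [Finsupp.smul_apply, map_smul, smul_eq_mul]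
    rfl
  · intro k hk
    have hlt : ∀ i, (k i : ℕ) < n := fun i => by
      by_contra! hi
      refine hk ?_
      beta_reduce
      rw [prod_wedgeCurrent_eq_zero (fun i => (k i : ℕ)) hi hβ, map_zero, Finsupp.zero_apply,
        mul_zero]
    rw [Finset.coe_map, Finset.coe_univ, Set.image_univ]
    exact ⟨fun i => ⟨(k i).natPred, (Nat.pred_le _).trans_lt (hlt i)⟩,
      funext fun i => (k i).succPNat_natPred⟩

theorem expElement_one (t : ℕ+ → K) (α β : StrictPartition) :
    expElement 1 t α β = (wedge K).repr (expOp t (wedge K β)) α := by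
  have hword {m : ℕ} (k : Fin m → ℕ+) :
      bra K α ((List.ofFn fun i => current K (1 * (k i : ℤ))).prod (ket K β)) =
        (wedge K).repr ((List.ofFn fun i => wedgeCurrent K (k i)).prod (wedge K β)) α := by
    simp only [one_mul]
    rw [ket_eq_toFock, prod_current_toFock, bra_toFock]
  rw [expOp, expEnd_apply, ← Module.Basis.coord_apply, map_finsum _
    ((isLocallyNilpotent_hamiltonian t).hasFiniteSupport_expTerm _)]
  simp only [expElement, hword, finsum_prod_wedgeCurrent, map_smul, smul_eq_mul,
    Module.Basis.coord_apply]

theorem bra_prod_current_neg {m : ℕ} (k : Fin m → ℕ+) (α β : StrictPartition) :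
    bra K α ((List.ofFn fun i => current K (-1 * (k i : ℤ))).prod (ket K β)) =
      bra K β ((List.ofFn fun i => current K (1 * (k i.rev : ℤ))).prod (ket K α)) := by
  have hadj := isAdjointPair_list_prod (K := K) (l := List.finRange m)
    (X := fun i => current K (-1 * (k i : ℤ))) (Y := fun i => current K (1 * (k i : ℤ)))
    fun i _ => by
      simpa using isAdjointPair_symm (isAdjointPair_current (K := K) (n := k i) (by simp))
  rw [List.finRange_reverse, List.map_map, ← List.ofFn_eq_map, ← List.ofFn_eq_map] at hadj
  rw [bra_apply, bra_apply, pairing_comm, hadj]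
  rfl

theorem expElement_neg_one (t : ℕ+ → K) (α β : StrictPartition) :
    expElement (-1) t α β = expElement 1 t β α := by
  rw [expElement, expElement]
  refine finsum_congr fun m => congrArg _ ?_
  rw [← finsum_comp_equiv (Equiv.arrowCongr Fin.revPerm (Equiv.refl ℕ+))]
  refine finsum_congr fun k => ?_
  rw [bra_prod_current_neg]
  congr 1
  · exact Equiv.prod_comp Fin.revPerm fun i => t (k i)
  · simp

end Current

/-! ### Matrix elements of one row -/

section RowElements

variable {K : Type*} [Field K]

theorem repr_create (p : ℕ) (v : FinWedge K) (S : Finset ℕ) :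
    (wedge K).repr (create K p v) S =
      if p ∈ S then wedgeSign K (S.erase p) p * (wedge K).repr v (S.erase p) else 0 := by
  have hcoord : (wedge K).coord S ∘ₗ create K p =
      if p ∈ S then wedgeSign K (S.erase p) p • (wedge K).coord (S.erase p) else 0 := by
    refine (wedge K).ext fun T => ?_
    rw [LinearMap.comp_apply, create_wedge]
    by_cases hT : p ∈ T <;> by_cases hS : p ∈ S
    · have hne : T ≠ S.erase p := fun h => Finset.notMem_erase p S (h ▸ hT)
      simp [hT, hS, hne]
    · simp [hT, hS]
    · rcases eq_or_ne T (S.erase p) with rfl | hne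
      · simp [hS]
      · have hne' : insert p T ≠ S := fun h => hne (by rw [← h, Finset.erase_insert hT])
        simp [hT, hS, hne, hne']
    · have hne : insert p T ≠ S := fun h => hS (h ▸ Finset.mem_insert_self p T)
      simp [hT, hS, hne]
  have happly := LinearMap.congr_fun hcoord v
  split_ifs at happly ⊢ with hp <;> exact happly

theorem repr_create_of_notMem {p : ℕ} {S : Finset ℕ} (hp : p ∉ S) (v : FinWedge K) :
    (wedge K).repr (create K p v) S = 0 := by
  rw [repr_create, if_neg hp]

theorem rowVec_range_self (w : Weights K) (l : ℕ) :
    rowVec w (Finset.range l) l Spin.plus = w.b₁ ^ l • wedge K (Finset.range l) ∧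
      rowVec w (Finset.range l) l Spin.minus = 0 := by
  induction l with
  | zero => simp [rowVec_zero]
  | succ l ih =>
    rw [Finset.range_add_one, rowVec_insert_succ_plus, rowVec_insert_succ_minus, ih.1, ih.2,
      map_zero, smul_zero, smul_zero, add_zero, map_smul, create_wedge_of_subset_range subset_rfl,
      smul_smul, pow_succ']
    exact ⟨rfl, rfl⟩

theorem transferOp_wedge_range (w : Weights K) {n l : ℕ} (hl : l ≤ n) :
    transferOp w n (wedge K (Finset.range l)) =
      (w.a₁ ^ (n - l) * w.b₁ ^ l) • wedge K (Finset.range l) := by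
  rw [transferOp_wedge]
  induction n, hl using Nat.le_induction with
  | base => rw [(rowVec_range_self w l).1, Nat.sub_self, pow_zero, one_mul]
  | succ n hl ih =>
    rw [rowVec_succ_plus w (Finset.range_subset_range.2 hl), ih, smul_smul, Nat.succ_sub hl,
      pow_succ', mul_assoc]

theorem rowVec_empty_one_minus (w : Weights K) :
    rowVec w ∅ 1 Spin.minus = w.c₂ • wedge K {0} := by
  have hcreate := create_wedge_of_subset_range (K := K) (Finset.empty_subset (Finset.range 0))
  rw [rowVec_succ_minus w (Finset.empty_subset _), rowVec_zero, rowVec_zero, if_pos rfl, hcreate]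
  simp

theorem repr_rowVec_empty_minus (w : Weights K) (n : ℕ) :
    (wedge K).repr (rowVec w ∅ (n + 1) Spin.minus) {0} = w.c₂ * w.b₂ ^ n := by
  induction n with
  | zero => simp [rowVec_empty_one_minus]
  | succ n ih =>
    rw [rowVec_succ_minus w (Finset.empty_subset _), map_add, map_smul, map_smul,
      Finsupp.add_apply, Finsupp.smul_apply, Finsupp.smul_apply, ih,
      repr_create_of_notMem (by simp), smul_zero, zero_add, smul_eq_mul, pow_succ]
    ring

theorem repr_transferOp_wedge_singleton (w : Weights K) (n : ℕ) :
    (wedge K).repr (transferOp w (n + 2) (wedge K {n + 1})) {0} = w.c₁ * w.c₂ * w.b₂ ^ n := by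
  rw [transferOp_wedge, ← insert_empty_eq, rowVec_insert_succ_plus, map_add, map_smul, map_smul,
    Finsupp.add_apply, Finsupp.smul_apply, Finsupp.smul_apply, repr_rowVec_empty_minus,
    repr_create_of_notMem (by simp), smul_zero, zero_add, smul_eq_mul, mul_assoc]

theorem rowVec_Icc_minus (w : Weights K) (n : ℕ) :
    rowVec w (Finset.Icc 1 n) (n + 1) Spin.minus =
      (w.a₂ ^ n * w.c₂) • wedge K (Finset.range (n + 1)) := by
  induction n with
  | zero => simp [rowVec_empty_one_minus]
  | succ n ih =>
    rw [← Finset.insert_Icc_right_eq_Icc_add_one (by simp), rowVec_insert_succ_minus, ih, map_smul,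
      create_wedge_of_subset_range subset_rfl, ← Finset.range_add_one, smul_smul, pow_succ',
      mul_assoc]

theorem repr_transferOp_wedge_Icc (w : Weights K) (n : ℕ) :
    (wedge K).repr (transferOp w (n + 2) (wedge K (Finset.Icc 1 (n + 1)))) (Finset.range (n + 1)) =
      w.c₁ * w.c₂ * w.a₂ ^ n := by
  rw [transferOp_wedge, ← Finset.insert_Icc_right_eq_Icc_add_one (by simp),
    rowVec_insert_succ_plus, rowVec_Icc_minus, map_add, map_smul, map_smul, map_smul,
    Finsupp.add_apply, Finsupp.smul_apply, Finsupp.smul_apply, Finsupp.smul_apply,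
    repr_create_of_notMem Finset.notMem_range_self, Module.Basis.repr_self_apply, if_pos rfl]
  simp only [smul_eq_mul]
  ring

end RowElements

/-! ### Matrix elements of the exponential -/

section ExpElements

variable {K : Type*} [Field K]

theorem expOp_wedge_range (t : ℕ+ → K) (l : ℕ) :
    expOp t (wedge K (Finset.range l)) = wedge K (Finset.range l) := by
  refine expEnd_apply_of_map_eq_zero _ ?_
  rw [hamiltonian_eq_sum_wedgeCurrent t (wedge_mem_sector subset_rfl)]
  refine Finset.sum_eq_zero fun j _ => ?_
  rw [wedgeCurrent_wedge, Finset.sum_eq_zero fun p hp => ?_, smul_zero]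
  simp only [Finset.mem_filter, Finset.mem_range] at hp
  have hmem : p - (j + 1) ∈ (Finset.range l).erase p :=
    Finset.mem_erase.2 ⟨by omega, Finset.mem_range.2 (by omega)⟩
  rw [annihilate_wedge, if_pos (Finset.mem_range.2 hp.1), map_smul, create_wedge, if_pos hmem,
    smul_zero]

variable [CharZero K]

theorem expOp_wedge_insert (t : ℕ+ → K) {p : ℕ} {S : Finset ℕ} (hS : S ⊆ Finset.range p) :
    expOp t (wedge K (insert p S)) = ∑ kl ∈ Finset.HasAntidiagonal.antidiagonal p,
      PowerSeries.coeff kl.1 (expSeries (currentSeries t)) •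
        create K kl.2 (expOp t (wedge K S)) := by
  have hexchange := (intertwines_expOp t).mul_wedgeMul (mode K p)
  rw [Module.End.one_apply, shiftAct_mode, wedgeMul_mode] at hexchange
  rw [← create_wedge_of_subset_range hS, ← Module.End.mul_apply, hexchange]
  simp only [Module.End.mul_apply, map_sum, map_smul, LinearMap.sum_apply, LinearMap.smul_apply,
    wedgeMul_mode]

theorem expOp_wedge_singleton (t : ℕ+ → K) (p : ℕ) :
    expOp t (wedge K {p}) = ∑ kl ∈ Finset.HasAntidiagonal.antidiagonal p,
      PowerSeries.coeff kl.1 (expSeries (currentSeries t)) • wedge K {kl.2} := by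
  rw [← insert_empty_eq, expOp_wedge_insert t (Finset.empty_subset _),
    (intertwines_expOp t).map_empty]
  simp only [create_wedge_of_subset_range (Finset.empty_subset _), insert_empty_eq]

theorem repr_expOp_wedge_singleton (t : ℕ+ → K) {p q : ℕ} (hq : q ≤ p) :
    (wedge K).repr (expOp t (wedge K {p})) {q} =
      PowerSeries.coeff (p - q) (expSeries (currentSeries t)) := by
  rw [expOp_wedge_singleton, map_sum, Finsupp.finsetSum_apply, Finset.sum_eq_single (p - q, q)]
  · simp
  · rintro ⟨k, l⟩ hkl hne
    have hl : l ≠ q := by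
      rintro rfl
      rw [Finset.HasAntidiagonal.mem_antidiagonal] at hkl
      exact hne (Prod.ext (Nat.eq_sub_of_add_eq hkl) rfl)
    simp [hl]
  · simp [hq]

theorem repr_expOp_wedge_Icc_one_two (t : ℕ+ → K) :
    (wedge K).repr (expOp t (wedge K (Finset.Icc 1 2))) (Finset.range 2) =
      PowerSeries.coeff 1 (expSeries (currentSeries t)) ^ 2 -
        PowerSeries.coeff 2 (expSeries (currentSeries t)) := by
  have hF := constantCoeff_expSeries (constantCoeff_currentSeries t)
  have herase₀ : (Finset.range 2).erase 0 = {1} := by decide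
  have herase₁ : (Finset.range 2).erase 1 = {0} := by decide
  rw [show Finset.Icc 1 2 = {2, 1} by decide, expOp_wedge_insert t (by decide)]
  simp [Finset.Nat.antidiagonal_succ, repr_create, repr_expOp_wedge_singleton, hF, herase₀,
    herase₁, wedgeSign, Finset.filter_singleton, pow_two, sub_eq_add_neg]

end ExpElements

/-! ### Matching row by row -/

section ExpMatches

variable {K : Type*} [Field K]

/-- The condition of `Matches` in terms of operators on finite wedges, with the parameters `u j k`
in place of `s_k^{(j+1)}`. -/
def ExpMatches (W : ℕ → Weights K) (u : ℕ → ℕ+ → K) (C : ℕ → ℕ → ℕ → K) : Prop :=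
  ∀ N M, ∀ lam ⊆ Finset.range (M + 1), transferProd W (M + 1) N (wedge K lam) =
    C N M lam.card • expOp (∑ j ∈ Finset.range N, u j) (wedge K lam)

theorem repr_eq_zero_of_mem_sector {n l : ℕ} {v : FinWedge K} (hv : v ∈ sector K n l)
    {mu : Finset ℕ} (hmu : ¬ mu ⊆ Finset.range n) : (wedge K).repr v mu = 0 := by
  by_contra hne
  exact hmu ((wedge K).mem_span_image.1 hv (Finsupp.mem_support_iff.2 hne)).1

theorem matches_iff_expMatches (W : ℕ → Weights K) (s : ℕ → ℤ → K) (C : ℕ → ℕ → ℕ → K) :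
    Matches W s C ↔ ExpMatches W (fun j k => s j k) C := by
  have hrange {S : Finset ℕ} {M : ℕ} : (∀ p ∈ S, p ≤ M) ↔ S ⊆ Finset.range (M + 1) := by
    simp only [Finset.subset_iff, Finset.mem_range, Nat.lt_succ_iff]
  have hZ (N M : ℕ) {lam mu : Finset ℕ} (hlam : lam ⊆ Finset.range (M + 1)) :
      (wedge K).repr (transferProd W (M + 1) N (wedge K lam)) mu =
        if mu ⊆ Finset.range (M + 1) then Z W N M lam mu else 0 := by
    rw [transferProd_wedge W N M hlam]
    simp [Finsupp.single_apply]
  simp only [Matches, ExpMatches, expPlus, expElement_one, hrange, Finset.sum_fn]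
  refine forall₂_congr fun N M => ⟨fun h lam hlam => ?_, fun h lam mu hlam hmu => ?_⟩
  · refine (wedge K).ext_elem fun mu => ?_
    rw [hZ N M hlam, map_smul, Finsupp.smul_apply, smul_eq_mul]
    split_ifs with hmu
    · exact h lam mu hlam hmu
    · rw [repr_eq_zero_of_mem_sector (expOp_mem_sector _ (wedge_mem_sector hlam)) hmu, mul_zero]
  · have hrepr := hZ N M (mu := mu) hlam
    rwa [if_pos hmu, h lam hlam, map_smul, Finsupp.smul_apply, smul_eq_mul, eq_comm] at hrepr

variable {W : ℕ → Weights K} {u : ℕ → ℕ+ → K} {C : ℕ → ℕ → ℕ → K}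

theorem ExpMatches.eqOn_sector (h : ExpMatches W u C) (N M l : ℕ) :
    Set.EqOn (transferProd W (M + 1) N)
      (C N M l • expOp (∑ j ∈ Finset.range N, u j) : Module.End K (FinWedge K))
      (sector K (M + 1) l) :=
  SixVertex.eqOn_sector fun S hS hl => hl ▸ h N M S hS

variable [CharZero K]

theorem ExpMatches.zero (h : ExpMatches W u C) {M l : ℕ} (hl : l ≤ M + 1) : C 0 M l = 1 := by
  have hrepr := congrArg (fun v => (wedge K).repr v (Finset.range l))
    (h 0 M _ (Finset.range_subset_range.2 hl))
  simpa [transferProd, expOp_zero, eq_comm] using hrepr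

theorem ExpMatches.row (h : ExpMatches W u C) (N M : ℕ) {lam : Finset ℕ}
    (hlam : lam ⊆ Finset.range (M + 1)) :
    C N M lam.card • transferOp (W N) (M + 1) (wedge K lam) =
      C (N + 1) M lam.card • expOp (u N) (wedge K lam) := by
  set t := ∑ j ∈ Finset.range N, u j with ht
  have hcancel : expOp t (expOp (-t) (wedge K lam)) = wedge K lam := by
    rw [← Module.End.mul_apply, ← expOp_add, add_neg_cancel, expOp_zero, Module.End.one_apply]
  have hv : expOp (-t) (wedge K lam) ∈ sector K (M + 1) lam.card :=
    expOp_mem_sector _ (wedge_mem_sector hlam)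
  have hN := h.eqOn_sector N M lam.card hv
  have hsucc := h.eqOn_sector (N + 1) M lam.card hv
  rw [LinearMap.smul_apply, ← ht, hcancel] at hN
  rwa [transferProd, Module.End.mul_apply, hN, map_smul, Finset.sum_range_succ, ← ht, add_comm t,
    expOp_add, LinearMap.smul_apply, Module.End.mul_apply, hcancel] at hsucc

theorem expMatches_of_rows (zero : ∀ M l, C 0 M l = 1)
    (row : ∀ N M, ∀ lam ⊆ Finset.range (M + 1),
      C N M lam.card • transferOp (W N) (M + 1) (wedge K lam) =
        C (N + 1) M lam.card • expOp (u N) (wedge K lam)) : ExpMatches W u C := by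
  intro N M lam hlam
  induction N with
  | zero => simp [transferProd, zero, expOp_zero]
  | succ N ih =>
    have hrow : Set.EqOn (C N M lam.card • transferOp (W N) (M + 1) : Module.End K (FinWedge K))
        (C (N + 1) M lam.card • expOp (u N) : Module.End K (FinWedge K))
        (sector K (M + 1) lam.card) :=
      eqOn_sector fun S hS hcard => hcard ▸ row N M S hS
    rw [transferProd, Module.End.mul_apply, ih, map_smul, ← LinearMap.smul_apply,
      hrow (expOp_mem_sector _ (wedge_mem_sector hlam)), Finset.sum_range_succ, add_comm _ (u N),
      expOp_add, LinearMap.smul_apply, Module.End.mul_apply]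

theorem expMatches_weights (x y A B : ℕ → K) :
    ExpMatches (weights x y A B) (fun j => superPowerSum (x j) (y j)) (factor A B) := by
  refine expMatches_of_rows (fun M l => Finset.prod_range_zero _) fun N M lam hlam => ?_
  rw [transferOp_weights_wedge x y A B N hlam, smul_smul, factor, factor, Finset.prod_range_succ]

theorem ExpMatches.factor_succ (h : ExpMatches W u C) (N : ℕ) {M l : ℕ} (hl : l ≤ M + 1) :
    C (N + 1) M l = C N M l * ((W N).a₁ ^ (M + 1 - l) * (W N).b₁ ^ l) := by
  have hrow := h.row N M (Finset.range_subset_range.2 hl)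
  rw [transferOp_wedge_range _ hl, expOp_wedge_range, Finset.card_range, smul_smul] at hrow
  exact (smul_left_injective K ((wedge K).ne_zero _) hrow).symm

theorem ExpMatches.transferOp_eq (h : ExpMatches W u C) (N M : ℕ) {lam : Finset ℕ}
    (hlam : lam ⊆ Finset.range (M + 1)) (hC : C N M lam.card ≠ 0) :
    transferOp (W N) (M + 1) (wedge K lam) =
      ((W N).a₁ ^ (M + 1 - lam.card) * (W N).b₁ ^ lam.card) • expOp (u N) (wedge K lam) := by
  have hcard : lam.card ≤ M + 1 := by simpa using Finset.card_le_card hlam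
  have hrow := h.row N M hlam
  rw [h.factor_succ N hcard, mul_smul] at hrow
  exact smul_right_injective _ hC hrow

theorem ExpMatches.a₁_b₁_ne_zero (h : ExpMatches W u C) (hc : ∀ i, (W i).c₁ ≠ 0 ∧ (W i).c₂ ≠ 0)
    (N : ℕ) : (W N).a₁ ≠ 0 ∧ (W N).b₁ ≠ 0 := by
  have hab {N : ℕ} (hC : C N 1 1 ≠ 0) : (W N).a₁ * (W N).b₁ ≠ 0 := fun hzero => by
    have hrepr := congrArg (fun v => (wedge K).repr v {0})
      (h.transferOp_eq N 1 (lam := {1}) (by decide) hC)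
    beta_reduce at hrepr
    rw [repr_transferOp_wedge_singleton (W N) 0, Finset.card_singleton, pow_one, pow_one, hzero,
      zero_smul, map_zero, Finsupp.zero_apply, pow_zero, mul_one] at hrepr
    exact mul_ne_zero (hc N).1 (hc N).2 hrepr
  have hC : ∀ N, C N 1 1 ≠ 0 := by
    intro N
    induction N with
    | zero => exact (h.zero (by decide)).trans_ne one_ne_zero
    | succ N ih =>
      rw [h.factor_succ N (by decide), pow_one, pow_one]
      exact mul_ne_zero ih (hab ih)
  exact mul_ne_zero_iff.1 (hab (hC N))

theorem ExpMatches.factor_ne_zero (h : ExpMatches W u C)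
    (hc : ∀ i, (W i).c₁ ≠ 0 ∧ (W i).c₂ ≠ 0) (N : ℕ) {M l : ℕ} (hl : l ≤ M + 1) : C N M l ≠ 0 := by
  induction N with
  | zero => exact (h.zero hl).trans_ne one_ne_zero
  | succ N ih =>
    obtain ⟨ha, hb⟩ := h.a₁_b₁_ne_zero hc N
    rw [h.factor_succ N hl]
    exact mul_ne_zero ih (mul_ne_zero (pow_ne_zero _ ha) (pow_ne_zero _ hb))

theorem ExpMatches.freeFermionic (h : ExpMatches W u C)
    (hc : ∀ i, (W i).c₁ ≠ 0 ∧ (W i).c₂ ≠ 0) (N : ℕ) : (W N).FreeFermionic := by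
  have hrow {M : ℕ} {lam : Finset ℕ} (hlam : lam ⊆ Finset.range (M + 1)) (mu : Finset ℕ) :
      (wedge K).repr (transferOp (W N) (M + 1) (wedge K lam)) mu =
        (W N).a₁ ^ (M + 1 - lam.card) * (W N).b₁ ^ lam.card *
          (wedge K).repr (expOp (u N) (wedge K lam)) mu := by
    have hcard : lam.card ≤ M + 1 := by simpa using Finset.card_le_card hlam
    rw [h.transferOp_eq N M hlam (h.factor_ne_zero hc N hcard), map_smul, Finsupp.smul_apply,
      smul_eq_mul]
  have hone := hrow (M := 1) (lam := {1}) (by decide) {0}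
  have htwo := hrow (M := 2) (lam := {2}) (by decide) {0}
  have hpair := hrow (M := 2) (lam := Finset.Icc 1 2) (by decide) (Finset.range 2)
  rw [repr_transferOp_wedge_singleton (W N) 0, repr_expOp_wedge_singleton _ zero_le_one] at hone
  rw [repr_transferOp_wedge_singleton (W N) 1, repr_expOp_wedge_singleton _ zero_le_two] at htwo
  rw [repr_transferOp_wedge_Icc (W N) 1, repr_expOp_wedge_Icc_one_two] at hpair
  simp only [Finset.card_singleton, Nat.card_Icc, pow_zero, pow_one, mul_one, Nat.sub_zero,
    Nat.reduceAdd, Nat.reduceSub] at hone htwo hpair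
  refine mul_left_cancel₀ (mul_ne_zero (hc N).1 (hc N).2) ?_
  linear_combination (W N).b₁ * htwo + (W N).a₁ * hpair -
    ((W N).c₁ * (W N).c₂ + (W N).a₁ * (W N).b₁ *
      PowerSeries.coeff 1 (expSeries (currentSeries (u N)))) * hone

theorem expSeries_injOn :
    Set.InjOn (expSeries : PowerSeries K → PowerSeries K) {h | h.constantCoeff = 0} := by
  intro h hh k hk heq
  rw [Set.mem_ofPred_eq] at hh hk
  have hne : expSeries k ≠ 0 := fun hzero => by simpa [hzero] using constantCoeff_expSeries hk
  refine PowerSeries.derivative.ext (mul_left_cancel₀ hne ?_) (hh.trans hk.symm)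
  rw [← derivative_expSeries hk, ← heq, derivative_expSeries hh]

theorem eq_of_expOp_wedge_singleton_eq {s t : ℕ+ → K}
    (h : ∀ p, expOp s (wedge K {p}) = expOp t (wedge K {p})) : s = t := by
  have hexp : expSeries (currentSeries s) = expSeries (currentSeries t) := by
    ext p
    rw [← Nat.sub_zero p, ← repr_expOp_wedge_singleton s p.zero_le, h,
      repr_expOp_wedge_singleton t p.zero_le]
  have hcurrent := expSeries_injOn (constantCoeff_currentSeries s) (constantCoeff_currentSeries t)
    hexp
  funext k
  rw [← PNat.succPNat_natPred k, ← coeff_succ_currentSeries s, hcurrent, coeff_succ_currentSeries]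

theorem expMatches_weights_iff {x y A B : ℕ → K} (hAB : ∀ i, A i ≠ 0 ∧ B i ≠ 0) :
    ExpMatches (weights x y A B) u (factor A B) ↔ ∀ j, u j = superPowerSum (x j) (y j) := by
  refine ⟨fun h j => eq_of_expOp_wedge_singleton_eq fun p => ?_, fun hu => ?_⟩
  · have hfactor : factor A B (j + 1) p 1 ≠ 0 := Finset.prod_ne_zero_iff.2 fun i _ =>
      mul_ne_zero (pow_ne_zero _ (hAB i).1) (pow_ne_zero _ (hAB i).2)
    have hp : ({p} : Finset ℕ) ⊆ Finset.range (p + 1) := by simp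
    exact smul_right_injective _ hfactor
      ((h.row j p hp).symm.trans ((expMatches_weights x y A B).row j p hp))
  · rw [funext hu]
    exact expMatches_weights x y A B

end ExpMatches

/-! ### The model and its dual -/

section Main

variable {K : Type*} [Field K]

theorem matches_iff_of_gaugeEquiv {W W' : ℕ → Weights K} (h : ∀ i, GaugeEquiv (W i) (W' i))
    {s : ℕ → ℤ → K} {C : ℕ → ℕ → ℕ → K} : Matches W s C ↔ Matches W' s C := by
  rw [matches_iff_expMatches, matches_iff_expMatches]
  refine forall₄_congr fun N M lam hlam => ?_
  rw [GaugeEquiv.transferProd_wedge_eq h N M hlam]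

theorem eq_superPowerSum_iff {f : ℤ → K} {x y : K} :
    (fun k : ℕ+ => f k) = superPowerSum x y ↔
      ∀ k : ℕ, 1 ≤ k → f k = (x ^ k + (-1) ^ (k - 1) * y ^ k) / k :=
  funext_iff.trans Subtype.forall

theorem gaugeEquiv_weights {W : ℕ → Weights K}
    (hab : ∀ i, (W i).a₁ ≠ 0 ∧ (W i).b₁ ≠ 0) (hW : ∀ i, (W i).FreeFermionic) (i : ℕ) :
    GaugeEquiv (W i) (weights (fun i => (W i).b₂ / (W i).a₁) (fun i => (W i).a₂ / (W i).b₁)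
      (fun i => (W i).a₁) (fun i => (W i).b₁ / (W i).a₁) i) := by
  obtain ⟨ha, hb⟩ := hab i
  have hi := hW i
  simp only [Weights.FreeFermionic] at hi
  constructor <;> simp only [weights] <;> field_simp
  linear_combination -hi

/-- The weights with `c₁` and `c₂` interchanged, as by reflection in a horizontal line followed by
exchanging the two kinds of models. -/
def Weights.swap (w : Weights K) : Weights K := { w with c₁ := w.c₂, c₂ := w.c₁ }

theorem Weights.freeFermionic_swap (w : Weights K) : w.swap.FreeFermionic ↔ w.FreeFermionic := by
  simp only [FreeFermionic, swap, mul_comm w.c₂]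

theorem Weights.dualVertex_eq (w : Weights K) (l t r b : Spin) :
    w.dualVertex l t r b = w.swap.vertex l b r t := by
  cases l <;> cases t <;> cases r <;> cases b <;> rfl

-- The dual model is a reflected model, and `e^{H₋}` is the transpose of an `e^{H₊}`.
theorem dualMatches_iff_matches_swap (W : ℕ → Weights K) (s : ℕ → ℤ → K) (C : ℕ → ℕ → ℕ → K) :
    DualMatches W s C ↔ Matches (fun i => (W i).swap) (fun j k => s j (-k)) C := by
  simp only [DualMatches, Matches, dualZ, Z, Weights.dualVertex_eq, expMinus, expPlus,
    expElement_neg_one]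

variable [CharZero K]

theorem matches_weights {x y A B : ℕ → K} {s : ℕ → ℤ → K}
    (hs : ∀ j, ∀ k : ℕ, 1 ≤ k → s j k = (x j ^ k + (-1) ^ (k - 1) * y j ^ k) / k) :
    Matches (weights x y A B) s (factor A B) := by
  rw [matches_iff_expMatches, funext fun j => eq_superPowerSum_iff.2 (hs j)]
  exact expMatches_weights x y A B

theorem matches_weights_iff {x y A B : ℕ → K} (s : ℕ → ℤ → K) (hAB : ∀ i, A i ≠ 0 ∧ B i ≠ 0) :
    Matches (weights x y A B) s (factor A B) ↔
      ∀ j, ∀ k : ℕ, 1 ≤ k → s j k = (x j ^ k + (-1) ^ (k - 1) * y j ^ k) / k := by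
  simp only [matches_iff_expMatches, expMatches_weights_iff hAB, eq_superPowerSum_iff]

theorem Matches.freeFermionic {W : ℕ → Weights K} {s : ℕ → ℤ → K} {C : ℕ → ℕ → ℕ → K}
    (h : Matches W s C) (hc : ∀ i, (W i).c₁ ≠ 0 ∧ (W i).c₂ ≠ 0) (i : ℕ) : (W i).FreeFermionic :=
  ((matches_iff_expMatches W s C).1 h).freeFermionic hc i

theorem exists_matches_iff_freeFermionic {W : ℕ → Weights K}
    (hc : ∀ i, (W i).c₁ ≠ 0 ∧ (W i).c₂ ≠ 0) (hab : ∀ i, (W i).a₁ ≠ 0 ∧ (W i).b₁ ≠ 0) :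
    (∃ s C, Matches W s C) ↔ ∀ i, (W i).FreeFermionic := by
  refine ⟨fun ⟨s, C, h⟩ => h.freeFermionic hc, fun hW => ?_⟩
  let s (j : ℕ) (k : ℤ) : K :=
    superPowerSum ((W j).b₂ / (W j).a₁) ((W j).a₂ / (W j).b₁) k.natAbs.toPNat'
  refine ⟨s, factor (fun i => (W i).a₁) fun i => (W i).b₁ / (W i).a₁,
    (matches_iff_of_gaugeEquiv (gaugeEquiv_weights hab hW)).2 ?_⟩
  rw [matches_iff_expMatches]
  simpa only [s, Int.natAbs_natCast, PNat.coe_toPNat'] using expMatches_weights _ _ _ _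

theorem dualMatches_dualWeights_iff {x y A B : ℕ → K} (s : ℕ → ℤ → K)
    (hAB : ∀ i, A i ≠ 0 ∧ B i ≠ 0) :
    DualMatches (dualWeights x y A B) s (fun N M l => (factor A B N M l)⁻¹) ↔
      ∀ j, ∀ k : ℕ, 1 ≤ k → s j (-k) = (y j ^ k + (-1) ^ (k - 1) * x j ^ k) / k := by
  have hfactor : (fun N M l => (factor A B N M l)⁻¹) =
      factor (fun i => (A i)⁻¹) fun i => (B i)⁻¹ := by
    funext N M l
    simp only [factor, ← Finset.prod_inv_distrib, mul_inv, inv_pow]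
  have hgauge (i : ℕ) : GaugeEquiv (dualWeights x y A B i).swap
      (weights y x (fun i => (A i)⁻¹) (fun i => (B i)⁻¹) i) := by
    constructor <;> simp only [Weights.swap, dualWeights, weights]
    ring
  rw [dualMatches_iff_matches_swap, hfactor, matches_iff_of_gaugeEquiv hgauge]
  exact matches_weights_iff _ fun i => ⟨inv_ne_zero (hAB i).1, inv_ne_zero (hAB i).2⟩

theorem DualMatches.freeFermionic {W : ℕ → Weights K} {s : ℕ → ℤ → K} {C : ℕ → ℕ → ℕ → K}
    (h : DualMatches W s C) (hc : ∀ i, (W i).c₁ ≠ 0 ∧ (W i).c₂ ≠ 0) (i : ℕ) :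
    (W i).FreeFermionic :=
  (W i).freeFermionic_swap.1 <|
    ((dualMatches_iff_matches_swap W s C).1 h).freeFermionic (fun i => (hc i).symm) i

theorem exists_dualMatches_iff_freeFermionic {W : ℕ → Weights K}
    (hc : ∀ i, (W i).c₁ ≠ 0 ∧ (W i).c₂ ≠ 0) (hab : ∀ i, (W i).a₁ ≠ 0 ∧ (W i).b₁ ≠ 0) :
    (∃ s C, DualMatches W s C) ↔ ∀ i, (W i).FreeFermionic := by
  refine ⟨fun ⟨s, C, h⟩ => h.freeFermionic hc, fun hW => ?_⟩
  obtain ⟨s, C, h⟩ := (exists_matches_iff_freeFermionic (W := fun i => (W i).swap)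
    (fun i => (hc i).symm) hab).2 fun i => (W i).freeFermionic_swap.2 (hW i)
  refine ⟨fun j k => s j (-k), C, (dualMatches_iff_matches_swap W _ C).2 ?_⟩
  simpa only [neg_neg] using h

end Main

end SixVertex

end

open SixVertex in
theorem theorem4p1 {K : Type*} [Field K] [CharZero K] :
    -- the model with weights `𝔖(x, y, A, B)`
    (∀ (x y A B : ℕ → K) (s : ℕ → ℤ → K),
      ((∀ j, ∀ k : ℕ, 1 ≤ k → s j k = (x j ^ k + (-1) ^ (k - 1) * y j ^ k) / k) →
        Matches (weights x y A B) s (factor A B)) ∧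
      ((∀ i, A i ≠ 0 ∧ B i ≠ 0) →
        (Matches (weights x y A B) s (factor A B) ↔
          ∀ j, ∀ k : ℕ, 1 ≤ k → s j k = (x j ^ k + (-1) ^ (k - 1) * y j ^ k) / k))) ∧
    -- the model with arbitrary weights
    (∀ W : ℕ → Weights K, (∀ i, (W i).c₁ ≠ 0 ∧ (W i).c₂ ≠ 0) →
      ((¬ ∀ i, (W i).FreeFermionic) → ∀ s C, ¬ Matches W s C) ∧
      ((∀ i, (W i).a₁ ≠ 0 ∧ (W i).b₁ ≠ 0) →
        ((∃ s C, Matches W s C) ↔ ∀ i, (W i).FreeFermionic))) ∧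
    -- the dual model with weights `𝔖*(x, y, A, B)`
    (∀ (x y A B : ℕ → K) (s : ℕ → ℤ → K), (∀ i, A i ≠ 0 ∧ B i ≠ 0) →
      (DualMatches (dualWeights x y A B) s (fun N M l => (factor A B N M l)⁻¹) ↔
        ∀ j, ∀ k : ℕ, 1 ≤ k → s j (-k) = (y j ^ k + (-1) ^ (k - 1) * x j ^ k) / k)) ∧
    -- the dual model with arbitrary weights
    (∀ W : ℕ → Weights K, (∀ i, (W i).c₁ ≠ 0 ∧ (W i).c₂ ≠ 0) →
      ((¬ ∀ i, (W i).FreeFermionic) → ∀ s C, ¬ DualMatches W s C) ∧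
      ((∀ i, (W i).a₁ ≠ 0 ∧ (W i).b₁ ≠ 0) →
        ((∃ s C, DualMatches W s C) ↔ ∀ i, (W i).FreeFermionic))) :=
  ⟨fun _ _ _ _ s => ⟨matches_weights, matches_weights_iff s⟩,
    fun _ hc => ⟨fun hW _ _ h => hW (h.freeFermionic hc), exists_matches_iff_freeFermionic hc⟩,
    fun _ _ _ _ => dualMatches_dualWeights_iff,
    fun _ hc => ⟨fun hW _ _ h => hW (h.freeFermionic hc), exists_dualMatches_iff_freeFermionic hc⟩⟩
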